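/- **Theorem (Semigroup Property).** A Young frame $\lambda$ is a finite weakly decreasing sequence of positive integers $\lambda_1\ge\lambda_2\ge\cdots$ (row lengths, continued by zeros), $|\lambda|=\sum_i\lambda_i$, and row-wise addition is $(\lambda+\lambda')_i=\lambda_i+\lambda'_i$. Let $e_T=r_Tc_T\in\mathbb{C}[S_k]$ be the Young symmetriser of a standard tableau $T$ of shape $\lambda$, $k=|\lambda|$; let $V_\lambda=\mathbb{C}[S_k]e_T$ be the corresponding irreducible representation of $S_k$, and let $U_\lambda=U_\lambda^{d}=e_T(\mathbb{C}^d)^{\otimes k}$, which is the irreducible polynomial representation of $\mathrm{GL}_d(\mathbb{C})$ (equivalently of $\mathrm{U}(d)$) with highest weight $\lambda$ if $\lambda$ has at most $d$ rows, and is $0$ otherwise. For $d\ge 0$, the Littlewood–Richardson coefficient $c_{\mu\nu}^{\lambda}$ of $\mathrm{GL}_d(\mathbb{C})$ is the multiplicity $\dim\mathrm{Hom}_{\mathrm{GL}_d(\mathbb{C})}(U_\lambda,U_\mu\otimes U_\nu)$ of $U_\lambda$ in $U_\mu\otimes U_\nu$. If $|\mu|=|\nu|=|\lambda|=k$, the Kronecker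 coefficient $g_{\mu\nu\lambda}$ is the multiplicity $\dim\mathrm{Hom}_{S_k}(V_\lambda,V_\mu\otimes V_\nu)$ of $V_\lambda$ in $V_\mu\otimes V_\nu$; otherwise $g_{\mu\nu\lambda}=0$. Then the triples $(\mu,\nu,\lambda)$ with nonzero coefficient form a semigroup under row-wise addition, both for $c$ and for $g$: 1. for every $d$ and all Young frames $\mu,\nu,\lambda,\mu',\nu',\lambda'$, if $c_{\mu\nu}^{\lambda}\neq0$ and $c_{\mu'\nu'}^{\lambda'}\neq0$ (for $\mathrm{GL}_d(\mathbb{C})$), then $c_{\mu+\mu',\,\nu+\nu'}^{\lambda+\lambda'}\neq0$ (for $\mathrm{GL}_d(\mathbb{C})$); 2. for all Young frames $\mu,\nu,\lambda,\mu',\nu',\lambda'$, if $g_{\mu\nu\lambda}\neq0$ and $g_{\mu'\nu'\lambda'}\neq0$, then $g_{\mu+\mu',\,\nu+\nu',\,\lambda+\lambda'}\neq0$. -/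

import Mathlib

open scoped TensorProduct

noncomputable section

namespace YoungDiagram

/-- Row-wise addition of Young diagrams: the `i`-th row of the sum has
`μ.rowLen i + ν.rowLen i` boxes (see `rowLen_rowAdd`). -/
def rowAdd (μ ν : YoungDiagram) : YoungDiagram where
  cells := (Finset.range (max (μ.colLen 0) (ν.colLen 0)) ×ˢ
    Finset.range (μ.rowLen 0 + ν.rowLen 0)).filter
      fun c => c.2 < μ.rowLen c.1 + ν.rowLen c.1
  isLowerSet := by
    rintro ⟨i, j⟩ ⟨i', j'⟩ h hc
    obtain ⟨hi : i' ≤ i, hj : j' ≤ j⟩ := h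
    have h1 := μ.rowLen_anti i' i hi
    have h2 := ν.rowLen_anti i' i hi
    simp only [Finset.coe_filter, Finset.mem_product, Finset.mem_range, Set.mem_ofPred_eq] at hc ⊢
    omega

instance : Add YoungDiagram := ⟨rowAdd⟩

theorem mem_rowAdd {μ ν : YoungDiagram} {i j : ℕ} :
    (i, j) ∈ μ + ν ↔ j < μ.rowLen i + ν.rowLen i := by
  change (i, j) ∈ (rowAdd μ ν).cells ↔ _
  simp only [rowAdd, Finset.mem_filter, Finset.mem_product, Finset.mem_range]
  refine ⟨fun h => h.2, fun h => ⟨⟨?_, ?_⟩, h⟩⟩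
  · rw [lt_max_iff, ← mem_iff_lt_colLen, ← mem_iff_lt_colLen, mem_iff_lt_rowLen,
      mem_iff_lt_rowLen]
    omega
  · have h1 := μ.rowLen_anti 0 i (Nat.zero_le _)
    have h2 := ν.rowLen_anti 0 i (Nat.zero_le _)
    omega

theorem rowLen_rowAdd (μ ν : YoungDiagram) (i : ℕ) :
    (μ + ν).rowLen i = μ.rowLen i + ν.rowLen i := by
  refine eq_of_forall_lt_iff fun j => ?_
  rw [← mem_iff_lt_rowLen, mem_rowAdd]

/-- The standard Young tableau of a frame with `k` boxes in which the numbers `0, …, k - 1` are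
written row by row, from left to right: `lam.box h i` is the box `(row, column)` that contains
the number `i`. -/
def box (lam : YoungDiagram) {k : ℕ} (h : lam.card = k) (i : Fin k) : ℕ × ℕ :=
  ofLex ((lam.cells.map toLex.toEmbedding).orderEmbOfFin ((Finset.card_map _).trans h) i)

open Classical in
/-- The sum `r_T` of all permutations that preserve every row of the tableau. -/
def rowSymmetriser (lam : YoungDiagram) {k : ℕ} (h : lam.card = k) :
    MonoidAlgebra ℂ (Equiv.Perm (Fin k)) :=
  ∑ π : Equiv.Perm (Fin k) with ∀ i, (lam.box h (π i)).1 = (lam.box h i).1,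
    MonoidAlgebra.single π 1

open Classical in
/-- The signed sum `c_T` of all permutations that preserve every column of the tableau. -/
def colAntisymmetriser (lam : YoungDiagram) {k : ℕ} (h : lam.card = k) :
    MonoidAlgebra ℂ (Equiv.Perm (Fin k)) :=
  ∑ π : Equiv.Perm (Fin k) with ∀ i, (lam.box h (π i)).2 = (lam.box h i).2,
    MonoidAlgebra.single π ((Equiv.Perm.sign π : ℤ) : ℂ)

/-- The Young symmetriser `e_T = r_T c_T`. -/
def symmetriser (lam : YoungDiagram) {k : ℕ} (h : lam.card = k) :
    MonoidAlgebra ℂ (Equiv.Perm (Fin k)) :=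
  lam.rowSymmetriser h * lam.colAntisymmetriser h

end YoungDiagram

theorem leftRegular_apply_eq_mul {k : ℕ} (π : Equiv.Perm (Fin k))
    (a : MonoidAlgebra ℂ (Equiv.Perm (Fin k))) :
    Representation.leftRegular ℂ (Equiv.Perm (Fin k)) π a = MonoidAlgebra.single π 1 * a := by
  induction a using MonoidAlgebra.induction_linear with
  | zero => simp
  | add x y hx hy => rw [map_add, hx, hy, mul_add]
  | single σ r => simp [MonoidAlgebra.single_mul_single]

/-- The left ideal `ℂ[S_k] e_T`. -/
def spechtSpace (lam : YoungDiagram) {k : ℕ} (h : lam.card = k) :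
    Submodule ℂ (MonoidAlgebra ℂ (Equiv.Perm (Fin k))) :=
  LinearMap.range (LinearMap.mulRight ℂ (lam.symmetriser h))

/-- The irreducible representation `V_λ` of `S_k`, for a Young frame `λ` with `k` boxes: the
left ideal `ℂ[S_k] e_T` with `S_k` acting by left multiplication. -/
def spechtRep (lam : YoungDiagram) {k : ℕ} (h : lam.card = k) :
    Representation ℂ (Equiv.Perm (Fin k)) (spechtSpace lam h) :=
  (Representation.leftRegular ℂ (Equiv.Perm (Fin k))).subrepresentation (spechtSpace lam h) (by
    rintro π _ ⟨a, rfl⟩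
    refine ⟨MonoidAlgebra.single π 1 * a, ?_⟩
    rw [leftRegular_apply_eq_mul]
    simp [mul_assoc])

/-- The tensor power `(ℂ^d)^{⊗k}`. -/
abbrev TensorPow (d k : ℕ) : Type := ⨂[ℂ] _ : Fin k, (Fin d → ℂ)

/-- The action `g ↦ g^{⊗k}` of `GL_d(ℂ)` on the tensor power. -/
def tensorGL (d k : ℕ) : Representation ℂ (GL (Fin d) ℂ) (TensorPow d k) where
  toFun g := PiTensorProduct.map fun _ => Matrix.toLin' (g : Matrix (Fin d) (Fin d) ℂ)
  map_one' := by
    simp only [Units.val_one, Matrix.toLin'_one]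
    exact PiTensorProduct.map_id
  map_mul' g h := by
    simp only [Units.val_mul, Matrix.toLin'_mul]
    exact PiTensorProduct.map_comp _ _

/-- The action of `S_k` on the tensor power by permuting the tensor factors. -/
def tensorPerm (d k : ℕ) : Representation ℂ (Equiv.Perm (Fin k)) (TensorPow d k) where
  toFun π := (PiTensorProduct.reindex ℂ (fun _ : Fin k => (Fin d → ℂ)) π).toLinearMap
  map_one' := by
    refine PiTensorProduct.ext (MultilinearMap.ext fun v => ?_)
    exact PiTensorProduct.reindex_tprod _ _
  map_mul' π σ := by
    refine PiTensorProduct.ext (MultilinearMap.ext fun v => ?_)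
    simp only [LinearMap.compMultilinearMap_apply, Module.End.mul_apply, LinearEquiv.coe_coe]
    rw [PiTensorProduct.reindex_tprod, PiTensorProduct.reindex_tprod,
      PiTensorProduct.reindex_tprod]
    rfl

theorem tensorGL_comm_tensorPerm (d k : ℕ) (g : GL (Fin d) ℂ)
    (a : MonoidAlgebra ℂ (Equiv.Perm (Fin k))) (v : TensorPow d k) :
    tensorGL d k g ((tensorPerm d k).asAlgebraHom a v) =
      (tensorPerm d k).asAlgebraHom a (tensorGL d k g v) := by
  induction a using MonoidAlgebra.induction_linear with
  | zero => simp
  | add x y hx hy => simp [hx, hy]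
  | single σ r =>
    rw [Representation.asAlgebraHom_single, LinearMap.smul_apply, LinearMap.smul_apply, map_smul]
    congr 1
    exact PiTensorProduct.map_reindex
      (fun _ => Matrix.toLin' (g : Matrix (Fin d) (Fin d) ℂ)) σ v

/-- The subspace `e_T (ℂ^d)^{⊗k}` of the tensor power, where `k = |λ|`. -/
def weylSpace (d : ℕ) (lam : YoungDiagram) : Submodule ℂ (TensorPow d lam.card) :=
  LinearMap.range ((tensorPerm d lam.card).asAlgebraHom (lam.symmetriser rfl))

/-- The representation `U_λ` of `GL_d(ℂ)` on `e_T (ℂ^d)^{⊗|λ|}`. It is the irreducible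
representation with highest weight `λ` if `λ` has at most `d` rows, and zero otherwise. -/
def weylRep (d : ℕ) (lam : YoungDiagram) : Representation ℂ (GL (Fin d) ℂ) (weylSpace d lam) :=
  (tensorGL d lam.card).subrepresentation (weylSpace d lam) (by
    rintro g _ ⟨v, rfl⟩
    exact ⟨tensorGL d lam.card g v, (tensorGL_comm_tensorPerm d _ g _ v).symm⟩)

/-- The Littlewood–Richardson coefficient `c_{μν}^λ`: the multiplicity
`dim Hom_{GL_d}(U_λ, U_μ ⊗ U_ν)` of `U_λ` in the representation `U_μ ⊗ U_ν` of `GL_d(ℂ)`. -/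
def littlewoodRichardson (d : ℕ) (μ ν lam : YoungDiagram) : ℕ :=
  Module.finrank ℂ
    (Representation.IntertwiningMap (weylRep d lam) ((weylRep d μ).tprod (weylRep d ν)))

/-- The Kronecker coefficient `g_{μνλ}` of three Young frames with the same number `k` of boxes:
the multiplicity `dim Hom_{S_k}(V_λ, V_μ ⊗ V_ν)` of `V_λ` in the representation `V_μ ⊗ V_ν`
of `S_k`. It is zero if the numbers of boxes differ. -/
def kronecker (μ ν lam : YoungDiagram) : ℕ :=
  if h : μ.card = lam.card ∧ ν.card = lam.card then
    Module.finrank ℂ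
      (Representation.IntertwiningMap (spechtRep lam rfl)
        ((spechtRep μ h.1).tprod (spechtRep ν h.2)))
  else 0

end

/-! A coefficient is nonzero exactly when a certain space contains a nonzero polynomial with
suitable properties. The spaces for two triples multiply into the space for their row-wise sum, and
the polynomial rings over ℂ that occur are domains, so the product of two witnesses is again a
witness.

For `GL_d`, `rowPoly` sends a pure tensor to a product of linear forms, where position `p` uses the
variables of the row of box `p`. Row symmetrisation then becomes a scalar, so `U_λ` embeds
(`weylPoly_injective`), and its image consists of the polynomials of column-antisymmetrised tensors
(`mem_range_weylPoly_iff`). The columns of `λ + λ'` are those of `λ` and of `λ'`, sorted by length.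
Hence the column antisymmetriser factors over two blocks (`IsBoxSum.colAntisymmetriser`), and the
images multiply (`weylPoly_mul_mem`). A bilinear form identifies `U_λ` with its dual, so an
intertwining map becomes a polynomial `P` at which two algebra homomorphisms agree for every `g`.
This condition survives products.

For `S_k`, a triple of permutations becomes a monomial in variables indexed by triples of rows, one
factor for each position (`triplePoly`). The diagonal action only permutes the positions. By
averaging, the coefficient is nonzero if and only if some tensor in `V_λ ⊗ V_μ ⊗ V_ν`, invariant or
not, has a nonzero polynomial (`finrank_spechtRep_ne_zero_iff`). Only the column antisymmetrisers
matter for this (`exists_rowTriplePoly_ne_zero_iff`), and they factor as before.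

What is needed about `r = r_T` and `c = c_T` is that `rc ∈ rcr·A` and `rc ∈ A·crc`, and the same
with `r` and `c` exchanged, where `A` is the group algebra (`exists_stabSum_mul_eq_right`,
`exists_stabSum_mul_eq_left`). This follows from the positivity of a Hermitian form and gives the
injectivity and nondegeneracy statements. -/

noncomputable section

/-! ### Signed sums over stabilisers in the group algebra -/

open Classical in
/-- The sum of the permutations `π` with `f ∘ π = f`, weighted by the character `χ`. -/
def stabSum {k : ℕ} (χ : Equiv.Perm (Fin k) →* ℤˣ) (f : Fin k → ℕ) :
    MonoidAlgebra ℂ (Equiv.Perm (Fin k)) :=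
  ∑ π : Equiv.Perm (Fin k) with ∀ i, f (π i) = f i, MonoidAlgebra.single π ((χ π : ℤ) : ℂ)

/-- The order of the stabiliser of `f`. -/
def stabCard {k : ℕ} (f : Fin k → ℕ) : ℕ :=
  Nat.card {π : Equiv.Perm (Fin k) // ∀ i, f (π i) = f i}

theorem stabCard_ne_zero {k : ℕ} (f : Fin k → ℕ) : stabCard f ≠ 0 := by
  have : Nonempty {π : Equiv.Perm (Fin k) // ∀ i, f (π i) = f i} := ⟨⟨1, fun _ => rfl⟩⟩
  exact Nat.card_pos.ne'

open Classical in
theorem stabCard_eq {k : ℕ} (f : Fin k → ℕ) :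
    (Finset.univ.filter fun π : Equiv.Perm (Fin k) => ∀ i, f (π i) = f i).card = stabCard f := by
  rw [stabCard, Nat.card_eq_fintype_card, Fintype.card_subtype]

theorem YoungDiagram.rowSymmetriser_eq (lam : YoungDiagram) {k : ℕ} (h : lam.card = k) :
    lam.rowSymmetriser h = stabSum 1 fun i => (lam.box h i).1 := by
  simp [YoungDiagram.rowSymmetriser, stabSum]

theorem YoungDiagram.colAntisymmetriser_eq (lam : YoungDiagram) {k : ℕ} (h : lam.card = k) :
    lam.colAntisymmetriser h = stabSum Equiv.Perm.sign fun i => (lam.box h i).2 := rfl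

theorem intUnit_mul_self (u : ℤˣ) : ((u : ℤ) : ℂ) * ((u : ℤ) : ℂ) = 1 := by
  rw [← Int.cast_mul, ← Units.val_mul, Int.units_mul_self]; simp

section
variable {k : ℕ} (χ : Equiv.Perm (Fin k) →* ℤˣ) (f : Fin k → ℕ)

open Classical in
theorem single_mul_stabSum (τ : Equiv.Perm (Fin k)) (hτ : ∀ i, f (τ i) = f i) :
    MonoidAlgebra.single τ (1 : ℂ) * stabSum χ f = ((χ τ : ℤ) : ℂ) • stabSum χ f := by
  rw [stabSum, Finset.mul_sum, Finset.smul_sum]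
  refine Finset.sum_bij' (fun π _ => τ * π) (fun π _ => τ⁻¹ * π) ?_ ?_ ?_ ?_ ?_
  · intro π hπ
    simp only [Finset.mem_filter, Finset.mem_univ, true_and] at hπ ⊢
    intro i; rw [Equiv.Perm.mul_apply, hτ, hπ]
  · intro π hπ
    simp only [Finset.mem_filter, Finset.mem_univ, true_and] at hπ ⊢
    intro i; rw [Equiv.Perm.mul_apply, ← hτ (τ⁻¹ (π i)), ← Equiv.Perm.mul_apply, mul_inv_cancel,
      Equiv.Perm.one_apply, hπ]
  · intros; simp
  · intros; simp
  · intro π _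
    rw [MonoidAlgebra.single_mul_single, MonoidAlgebra.smul_single, map_mul, smul_eq_mul, one_mul]
    congr 1
    push_cast
    rw [← mul_assoc, intUnit_mul_self, one_mul]

open Classical in
theorem stabSum_mul_self : stabSum χ f * stabSum χ f = (stabCard f : ℂ) • stabSum χ f := by
  conv_lhs => enter [1]; rw [stabSum]
  rw [Finset.sum_mul]
  have : ∀ π ∈ Finset.univ.filter (fun π : Equiv.Perm (Fin k) => ∀ i, f (π i) = f i),
      MonoidAlgebra.single π ((χ π : ℤ) : ℂ) * stabSum χ f = stabSum χ f := by
    intro π hπ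
    have hs : MonoidAlgebra.single π ((χ π : ℤ) : ℂ) =
        ((χ π : ℤ) : ℂ) • MonoidAlgebra.single π (1 : ℂ) := by
      rw [MonoidAlgebra.smul_single, smul_eq_mul, mul_one]
    rw [hs, smul_mul_assoc, single_mul_stabSum χ f π (by simpa using hπ), smul_smul,
      intUnit_mul_self, one_smul]
  rw [Finset.sum_congr rfl this, Finset.sum_const, stabCard_eq, Nat.cast_smul_eq_nsmul]

/-- The antipode of the group algebra, induced by `π ↦ π⁻¹`. -/
def groupInv (k : ℕ) :
    MonoidAlgebra ℂ (Equiv.Perm (Fin k)) →ₗ[ℂ] MonoidAlgebra ℂ (Equiv.Perm (Fin k)) :=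
  HopfAlgebra.antipode ℂ

theorem groupInv_single (π : Equiv.Perm (Fin k)) (z : ℂ) :
    groupInv k (MonoidAlgebra.single π z) = MonoidAlgebra.single π⁻¹ z := by
  simp [groupInv]

theorem groupInv_mul (a b : MonoidAlgebra ℂ (Equiv.Perm (Fin k))) :
    groupInv k (a * b) = groupInv k b * groupInv k a := by
  induction a using MonoidAlgebra.induction_linear with
  | zero => simp
  | add x y hx hy => simp [add_mul, mul_add, hx, hy]
  | single σ z =>
    induction b using MonoidAlgebra.induction_linear with
    | zero => simp
    | add x y hx hy => simp [add_mul, mul_add, hx, hy]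
    | single τ w => simp [MonoidAlgebra.single_mul_single, groupInv_single, mul_comm]

open Classical in
theorem sum_stab_inv {M : Type*} [AddCommMonoid M] (F : Equiv.Perm (Fin k) → M) :
    ∑ π : Equiv.Perm (Fin k) with ∀ i, f (π i) = f i, F π⁻¹ =
      ∑ π : Equiv.Perm (Fin k) with ∀ i, f (π i) = f i, F π := by
  have key : ∀ π : Equiv.Perm (Fin k), (∀ i, f (π i) = f i) → ∀ i, f (π⁻¹ i) = f i := by
    intro π hπ i
    rw [← hπ (π⁻¹ i), ← Equiv.Perm.mul_apply, mul_inv_cancel, Equiv.Perm.one_apply]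
  refine Finset.sum_bij' (fun π _ => π⁻¹) (fun π _ => π⁻¹) ?_ ?_ ?_ ?_ ?_
  · intro π hπ; simpa using key π (by simpa using hπ)
  · intro π hπ; simpa using key π (by simpa using hπ)
  · simp
  · simp
  · simp

open Classical in
theorem groupInv_stabSum : groupInv k (stabSum χ f) = stabSum χ f := by
  rw [stabSum, map_sum, ← sum_stab_inv]
  refine Finset.sum_congr rfl fun π _ => ?_
  rw [groupInv_single, map_inv, Int.units_inv_eq_self, inv_inv]

/-- The standard Hermitian form of the group algebra. -/
def groupHerm (x y : MonoidAlgebra ℂ (Equiv.Perm (Fin k))) : ℂ :=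
  ∑ g, starRingEnd ℂ (x.coeff g) * y.coeff g

theorem eq_zero_of_groupHerm_self {x : MonoidAlgebra ℂ (Equiv.Perm (Fin k))}
    (h : groupHerm x x = 0) : x = 0 := by
  have h' : ∑ g, ‖x.coeff g‖ ^ 2 = 0 := by
    have : ((∑ g, ‖x.coeff g‖ ^ 2 : ℝ) : ℂ) = 0 := by
      rw [← h, groupHerm]; push_cast
      exact Finset.sum_congr rfl fun g _ => (Complex.conj_mul' _).symm
    exact_mod_cast this
  rw [Finset.sum_eq_zero_iff_of_nonneg (fun _ _ => by positivity)] at h'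
  ext g
  simpa using h' g (Finset.mem_univ g)

theorem groupHerm_single_mul (π : Equiv.Perm (Fin k)) (n : ℤ)
    (x y : MonoidAlgebra ℂ (Equiv.Perm (Fin k))) :
    groupHerm (MonoidAlgebra.single π (n : ℂ) * x) y =
      groupHerm x (MonoidAlgebra.single π⁻¹ (n : ℂ) * y) := by
  unfold groupHerm
  rw [← Equiv.sum_comp (Equiv.mulLeft π)]
  refine Finset.sum_congr rfl fun g _ => ?_
  simp only [MonoidAlgebra.coeff_single_mul_apply, Equiv.coe_mulLeft, inv_mul_cancel_left, map_mul,
    map_intCast, inv_inv]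
  ring

/-- The stabiliser is closed under inversion and the coefficients `±1` are real with `χ π⁻¹ = χ π`,
so signed stabiliser sums are self-adjoint. -/
theorem groupHerm_stabSum_mul (x y : MonoidAlgebra ℂ (Equiv.Perm (Fin k))) :
    groupHerm (stabSum χ f * x) y = groupHerm x (stabSum χ f * y) := by
  classical
  have hl : ∀ (s : Finset (Equiv.Perm (Fin k)))
      (F : Equiv.Perm (Fin k) → MonoidAlgebra ℂ (Equiv.Perm (Fin k))) (z),
      groupHerm (∑ π ∈ s, F π) z = ∑ π ∈ s, groupHerm (F π) z := by
    intro s F z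
    simp only [groupHerm, MonoidAlgebra.coeff_sum, Finsupp.finsetSum_apply, map_sum,
      Finset.sum_mul]
    exact Finset.sum_comm
  have hr : ∀ (s : Finset (Equiv.Perm (Fin k)))
      (F : Equiv.Perm (Fin k) → MonoidAlgebra ℂ (Equiv.Perm (Fin k))) (z),
      groupHerm z (∑ π ∈ s, F π) = ∑ π ∈ s, groupHerm z (F π) := by
    intro s F z
    simp only [groupHerm, MonoidAlgebra.coeff_sum, Finsupp.finsetSum_apply, Finset.mul_sum]
    exact Finset.sum_comm
  rw [stabSum, Finset.sum_mul, Finset.sum_mul, hl, hr, ← sum_stab_inv]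
  refine Finset.sum_congr rfl fun π _ => ?_
  rw [groupHerm_single_mul, map_inv, Int.units_inv_eq_self, inv_inv]

variable (χ' : Equiv.Perm (Fin k) →* ℤˣ) (f' : Fin k → ℕ)

/-- For `s`, `t` self-adjoint, `t s x` vanishes as soon as `s t s x` does. -/
theorem stabSum_mul_eq_zero {x : MonoidAlgebra ℂ (Equiv.Perm (Fin k))}
    (h : stabSum χ f * (stabSum χ' f' * (stabSum χ f * x)) = 0) :
    stabSum χ' f' * (stabSum χ f * x) = 0 := by
  apply eq_zero_of_groupHerm_self
  rw [groupHerm_stabSum_mul, groupHerm_stabSum_mul, ← mul_assoc (stabSum χ' f') (stabSum χ' f'),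
    stabSum_mul_self, smul_mul_assoc, mul_smul_comm, h]
  simp [groupHerm]

/-- Left multiplication by `sts` maps the right ideal `stA` to itself. It is injective there by
positivity, hence surjective by finite dimension, so `st` lies in its image. -/
theorem exists_stabSum_mul_eq_right :
    ∃ b, stabSum χ f * stabSum χ' f' = stabSum χ f * stabSum χ' f' * stabSum χ f * b := by
  set s := stabSum χ f
  set t := stabSum χ' f'
  let E := LinearMap.range (LinearMap.mulLeft ℂ (s * t))
  let F : E →ₗ[ℂ] E := (LinearMap.mulLeft ℂ (s * t * s)).restrict (by
    rintro _ ⟨x, rfl⟩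
    exact ⟨s * (s * t * x), by simp [mul_assoc]⟩)
  have hF : Function.Injective F := by
    rw [← LinearMap.ker_eq_bot, LinearMap.ker_eq_bot']
    rintro ⟨_, x, rfl⟩ h
    have h : s * (t * (s * (s * (t * x)))) = 0 := by
      simpa [F, LinearMap.restrict_apply, mul_assoc] using congrArg Subtype.val h
    have h1 : s * (t * (s * (t * x))) = 0 := by
      rw [← mul_assoc s s, stabSum_mul_self, smul_mul_assoc, mul_smul_comm, mul_smul_comm,
        smul_eq_zero] at h
      exact h.resolve_left (Nat.cast_ne_zero.mpr (stabCard_ne_zero f))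
    -- From `stst·x = 0`, strip the leading `s`, then the leading `t`, to reach `st·x = 0`.
    have h2 := stabSum_mul_eq_zero χ f χ' f' h1
    have h3 := stabSum_mul_eq_zero χ' f' χ f h2
    ext1
    simpa [mul_assoc] using h3
  obtain ⟨⟨_, y, rfl⟩, hy⟩ := LinearMap.surjective_of_injective hF ⟨s * t, 1, by simp⟩
  exact ⟨s * t * y, by
    simpa [F, LinearMap.restrict_apply, mul_assoc] using (congrArg Subtype.val hy).symm⟩

/-- The antipode fixes both sums and reverses products, so this is the mirror image of the
right-hand version for `ts`. -/
theorem exists_stabSum_mul_eq_left :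
    ∃ b, stabSum χ f * stabSum χ' f' = b * stabSum χ' f' * stabSum χ f * stabSum χ' f' := by
  obtain ⟨b, hb⟩ := exists_stabSum_mul_eq_right χ' f' χ f
  refine ⟨groupInv k b, ?_⟩
  simpa only [groupInv_mul, groupInv_stabSum, mul_assoc] using congrArg (groupInv k) hb

end
end

noncomputable section

/-! ### Boxes of a row-wise sum of Young diagrams -/

namespace YoungDiagram

theorem box_mem (lam : YoungDiagram) {k : ℕ} (h : lam.card = k) (i : Fin k) :
    lam.box h i ∈ lam := by
  have := Finset.orderEmbOfFin_mem (lam.cells.map toLex.toEmbedding)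
    ((Finset.card_map _).trans h) i
  obtain ⟨x, hx, hx'⟩ := Finset.mem_map.1 this
  rw [box, ← hx']
  exact hx

theorem box_injective (lam : YoungDiagram) {k : ℕ} (h : lam.card = k) :
    Function.Injective (lam.box h) := fun _ _ hij =>
  (Finset.orderEmbOfFin _ _).injective (ofLex.injective hij)

theorem exists_box_eq (lam : YoungDiagram) {k : ℕ} (h : lam.card = k) {c : ℕ × ℕ} (hc : c ∈ lam) :
    ∃ i, lam.box h i = c := by
  have : toLex c ∈ Set.range ((lam.cells.map toLex.toEmbedding).orderEmbOfFin
      ((Finset.card_map _).trans h)) := by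
    rw [Finset.range_orderEmbOfFin]
    simpa using hc
  obtain ⟨i, hi⟩ := this
  exact ⟨i, by rw [box, hi, ofLex_toLex]⟩

theorem lt_colLen_iff {lam : YoungDiagram} {i j : ℕ} : i < lam.colLen j ↔ j < lam.rowLen i := by
  rw [← mem_iff_lt_colLen, mem_iff_lt_rowLen]

/-- The columns of a given positive length form an interval bounded by two consecutive row lengths.
For a row-wise sum the length of this interval is the sum of the two lengths, which is what makes
`sumBox` possible. -/
theorem colLen_eq_iff {lam : YoungDiagram} {L j : ℕ} :
    lam.colLen j = L + 1 ↔ lam.rowLen (L + 1) ≤ j ∧ j < lam.rowLen L := by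
  rw [← lt_colLen_iff, ← not_lt, ← lt_colLen_iff]
  omega

/-- Where the boxes of two diagrams go in their row-wise sum: among the columns of a given length,
those of the first diagram come first. -/
def sumBox (lam lam' : YoungDiagram) : (ℕ × ℕ) ⊕ (ℕ × ℕ) → ℕ × ℕ
  | .inl c => (c.1, c.2 + lam'.rowLen (lam.colLen c.2))
  | .inr c => (c.1, c.2 + lam.rowLen (lam'.colLen c.2 - 1))

variable {lam lam' : YoungDiagram}

theorem colLen_sumBox_inl {c : ℕ × ℕ} (hc : c ∈ lam) :
    (lam + lam').colLen (sumBox lam lam' (.inl c)).2 = lam.colLen c.2 := by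
  obtain ⟨i, j⟩ := c
  obtain ⟨L, hL⟩ : ∃ L, lam.colLen j = L + 1 :=
    ⟨lam.colLen j - 1, by have := mem_iff_lt_colLen.1 hc; omega⟩
  have h := colLen_eq_iff.1 hL
  have := lam'.rowLen_anti L (L + 1) (by omega)
  simp only [sumBox, hL, colLen_eq_iff, rowLen_rowAdd]
  omega

theorem colLen_sumBox_inr {c : ℕ × ℕ} (hc : c ∈ lam') :
    (lam + lam').colLen (sumBox lam lam' (.inr c)).2 = lam'.colLen c.2 := by
  obtain ⟨i, j⟩ := c
  obtain ⟨L, hL⟩ : ∃ L, lam'.colLen j = L + 1 :=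
    ⟨lam'.colLen j - 1, by have := mem_iff_lt_colLen.1 hc; omega⟩
  have h := colLen_eq_iff.1 hL
  have := lam.rowLen_anti L (L + 1) (by omega)
  simp only [sumBox, hL, colLen_eq_iff, rowLen_rowAdd, Nat.add_sub_cancel]
  omega

theorem sumBox_inl_mem {c : ℕ × ℕ} (hc : c ∈ lam) : sumBox lam lam' (.inl c) ∈ lam + lam' := by
  rw [mem_iff_lt_colLen (i := (sumBox lam lam' (.inl c)).1), colLen_sumBox_inl hc]
  exact mem_iff_lt_colLen.1 hc

theorem sumBox_inr_mem {c : ℕ × ℕ} (hc : c ∈ lam') : sumBox lam lam' (.inr c) ∈ lam + lam' := by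
  rw [mem_iff_lt_colLen (i := (sumBox lam lam' (.inr c)).1), colLen_sumBox_inr hc]
  exact mem_iff_lt_colLen.1 hc

/-- The image column determines the column length, and on columns of one length the shift is
constant. -/
theorem sumBox_inl_snd_inj {c d : ℕ × ℕ} (hc : c ∈ lam) (hd : d ∈ lam) :
    (sumBox lam lam' (.inl c)).2 = (sumBox lam lam' (.inl d)).2 ↔ c.2 = d.2 := by
  refine ⟨fun h => ?_, fun h => by simp only [sumBox, h]⟩
  have h' := congrArg (lam + lam').colLen h
  rw [colLen_sumBox_inl hc, colLen_sumBox_inl hd] at h'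
  simp only [sumBox, h'] at h
  omega

theorem sumBox_inr_snd_inj {c d : ℕ × ℕ} (hc : c ∈ lam') (hd : d ∈ lam') :
    (sumBox lam lam' (.inr c)).2 = (sumBox lam lam' (.inr d)).2 ↔ c.2 = d.2 := by
  refine ⟨fun h => ?_, fun h => by simp only [sumBox, h]⟩
  have h' := congrArg (lam + lam').colLen h
  rw [colLen_sumBox_inr hc, colLen_sumBox_inr hd] at h'
  simp only [sumBox, h'] at h
  omega

/-- Columns that meet would have the same length `L + 1`. Among these, the images from `lam` lie
strictly left of `lam.rowLen L + lam'.rowLen (L + 1)`, and those from `lam'` start there. -/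
theorem sumBox_inl_snd_ne_inr {c d : ℕ × ℕ} (hc : c ∈ lam) (hd : d ∈ lam') :
    (sumBox lam lam' (.inl c)).2 ≠ (sumBox lam lam' (.inr d)).2 := by
  intro h
  have h' := congrArg (lam + lam').colLen h
  rw [colLen_sumBox_inl hc, colLen_sumBox_inr hd] at h'
  obtain ⟨L, hL⟩ : ∃ L, lam.colLen c.2 = L + 1 :=
    ⟨lam.colLen c.2 - 1, by have := mem_iff_lt_colLen.1 (show (c.1, c.2) ∈ lam from hc); omega⟩
  have h1 := colLen_eq_iff.1 hL
  have h2 := colLen_eq_iff.1 (h'.symm.trans hL)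
  simp only [sumBox, ← h', hL, Nat.add_sub_cancel] at h
  omega

theorem exists_sumBox_eq {c : ℕ × ℕ} (hc : c ∈ lam + lam') :
    (∃ d ∈ lam, sumBox lam lam' (.inl d) = c) ∨ ∃ d ∈ lam', sumBox lam lam' (.inr d) = c := by
  obtain ⟨i, j⟩ := c
  have hi := mem_iff_lt_colLen.1 hc
  obtain ⟨L, hL⟩ : ∃ L, (lam + lam').colLen j = L + 1 := ⟨(lam + lam').colLen j - 1, by omega⟩
  have h := colLen_eq_iff.1 hL
  simp only [rowLen_rowAdd] at h
  -- This is the point where the columns of length `L + 1` change from those of `lam` to those of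
  -- `lam'`.
  rcases lt_or_ge j (lam.rowLen L + lam'.rowLen (L + 1)) with hj | hj
  · have hl : lam.colLen (j - lam'.rowLen (L + 1)) = L + 1 := by rw [colLen_eq_iff]; omega
    refine Or.inl ⟨(i, j - lam'.rowLen (L + 1)), ?_, ?_⟩
    · rw [mem_iff_lt_colLen]; omega
    · simp only [sumBox, hl, Prod.mk.injEq, true_and]; omega
  · have hl : lam'.colLen (j - lam.rowLen L) = L + 1 := by rw [colLen_eq_iff]; omega
    refine Or.inr ⟨(i, j - lam.rowLen L), ?_, ?_⟩
    · rw [mem_iff_lt_colLen]; omega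
    · simp only [sumBox, hl, Prod.mk.injEq, true_and, Nat.add_sub_cancel]; omega

/-- A bijection `β` from the boxes of two diagrams onto those of their row-wise sum that respects
rows and matches up the columns. -/
structure IsBoxSum {k k' n : ℕ} (h : lam.card = k) (h' : lam'.card = k')
    (h'' : (lam + lam').card = n) (β : Fin k ⊕ Fin k' ≃ Fin n) : Prop where
  row_inl : ∀ p, ((lam + lam').box h'' (β (.inl p))).1 = (lam.box h p).1
  row_inr : ∀ p, ((lam + lam').box h'' (β (.inr p))).1 = (lam'.box h' p).1
  col_inl : ∀ p q, ((lam + lam').box h'' (β (.inl p))).2 = ((lam + lam').box h'' (β (.inl q))).2 ↔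
    (lam.box h p).2 = (lam.box h q).2
  col_inr : ∀ p q, ((lam + lam').box h'' (β (.inr p))).2 = ((lam + lam').box h'' (β (.inr q))).2 ↔
    (lam'.box h' p).2 = (lam'.box h' q).2
  col_ne : ∀ p q, ((lam + lam').box h'' (β (.inl p))).2 ≠ ((lam + lam').box h'' (β (.inr q))).2

theorem exists_isBoxSum {k k' n : ℕ} (h : lam.card = k) (h' : lam'.card = k')
    (h'' : (lam + lam').card = n) : ∃ β : Fin k ⊕ Fin k' ≃ Fin n, IsBoxSum h h' h'' β := by
  choose u hu using fun p => exists_box_eq (lam + lam') h''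
    (sumBox_inl_mem (lam' := lam') (box_mem lam h p))
  choose v hv using fun p => exists_box_eq (lam + lam') h''
    (sumBox_inr_mem (lam := lam) (box_mem lam' h' p))
  have hbij : Function.Bijective (Sum.elim u v) := by
    constructor
    · rintro (p | p) (q | q) hpq <;> simp only [Sum.elim_inl, Sum.elim_inr] at hpq
      · have e := congrArg ((lam + lam').box h'') hpq
        rw [hu, hu] at e
        exact congrArg _ (box_injective lam h (Prod.ext (by simpa [sumBox] using congrArg Prod.fst e)
          ((sumBox_inl_snd_inj (box_mem lam h p) (box_mem lam h q)).1 (congrArg Prod.snd e))))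
      · have e := congrArg (fun x => ((lam + lam').box h'' x).2) hpq
        simp only [hu, hv] at e
        exact absurd e (sumBox_inl_snd_ne_inr (box_mem lam h p) (box_mem lam' h' q))
      · have e := congrArg (fun x => ((lam + lam').box h'' x).2) hpq
        simp only [hu, hv] at e
        exact absurd e.symm (sumBox_inl_snd_ne_inr (box_mem lam h q) (box_mem lam' h' p))
      · have e := congrArg ((lam + lam').box h'') hpq
        rw [hv, hv] at e
        exact congrArg _ (box_injective lam' h' (Prod.ext (by simpa [sumBox] using congrArg Prod.fst e)
          ((sumBox_inr_snd_inj (box_mem lam' h' p) (box_mem lam' h' q)).1 (congrArg Prod.snd e))))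
    · intro q
      rcases exists_sumBox_eq (box_mem (lam + lam') h'' q) with ⟨d, hd, e⟩ | ⟨d, hd, e⟩
      · obtain ⟨p, rfl⟩ := exists_box_eq lam h hd
        exact ⟨.inl p, box_injective _ h'' ((hu p).trans e)⟩
      · obtain ⟨p, rfl⟩ := exists_box_eq lam' h' hd
        exact ⟨.inr p, box_injective _ h'' ((hv p).trans e)⟩
  refine ⟨Equiv.ofBijective _ hbij, ?_, ?_, ?_, ?_, ?_⟩
  · intro p; simp [hu, sumBox]
  · intro p; simp [hv, sumBox]
  · intro p q
    simp only [Equiv.ofBijective_apply, Sum.elim_inl, hu]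
    exact sumBox_inl_snd_inj (box_mem lam h p) (box_mem lam h q)
  · intro p q
    simp only [Equiv.ofBijective_apply, Sum.elim_inr, hv]
    exact sumBox_inr_snd_inj (box_mem lam' h' p) (box_mem lam' h' q)
  · intro p q
    simp only [Equiv.ofBijective_apply, Sum.elim_inl, Sum.elim_inr, hu, hv]
    exact sumBox_inl_snd_ne_inr (box_mem lam h p) (box_mem lam' h' q)

theorem card_rowAdd (lam lam' : YoungDiagram) : (lam + lam').card = lam.card + lam'.card := by
  obtain ⟨β, -⟩ := exists_isBoxSum (lam := lam) (lam' := lam') rfl rfl rfl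
  simpa using (Fintype.card_congr β).symm

end YoungDiagram

/-! ### Block permutations -/

section
variable {k k' n : ℕ} (β : Fin k ⊕ Fin k' ≃ Fin n)

/-- The permutation of `Fin n` that acts as `σ` and `σ'` on the two blocks. -/
def blockPerm : Equiv.Perm (Fin k) × Equiv.Perm (Fin k') →* Equiv.Perm (Fin n) where
  toFun σ := β.permCongr (Equiv.Perm.sumCongr σ.1 σ.2)
  map_one' := by ext; simp
  map_mul' σ τ := by
    ext x
    obtain ⟨y, rfl⟩ := β.surjective x
    rcases y with y | y <;> simp [Equiv.permCongr_apply]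

@[simp] theorem blockPerm_inl (σ : Equiv.Perm (Fin k) × Equiv.Perm (Fin k')) (p : Fin k) :
    blockPerm β σ (β (.inl p)) = β (.inl (σ.1 p)) := by simp [blockPerm, Equiv.permCongr_apply]

@[simp] theorem blockPerm_inr (σ : Equiv.Perm (Fin k) × Equiv.Perm (Fin k')) (p : Fin k') :
    blockPerm β σ (β (.inr p)) = β (.inr (σ.2 p)) := by simp [blockPerm, Equiv.permCongr_apply]

theorem sign_blockPerm (σ : Equiv.Perm (Fin k) × Equiv.Perm (Fin k')) :
    Equiv.Perm.sign (blockPerm β σ) = Equiv.Perm.sign σ.1 * Equiv.Perm.sign σ.2 := by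
  simp only [blockPerm, MonoidHom.coe_mk, OneHom.coe_mk, Equiv.Perm.sign_permCongr,
    Equiv.Perm.sign_sumCongr]

/-- The algebra map induced by permutations of the first block. -/
def blockLeft : MonoidAlgebra ℂ (Equiv.Perm (Fin k)) →ₐ[ℂ] MonoidAlgebra ℂ (Equiv.Perm (Fin n)) :=
  MonoidAlgebra.mapDomainAlgHom ℂ ℂ ((blockPerm β).comp (MonoidHom.inl _ _))

/-- The algebra map induced by permutations of the second block. -/
def blockRight :
    MonoidAlgebra ℂ (Equiv.Perm (Fin k')) →ₐ[ℂ] MonoidAlgebra ℂ (Equiv.Perm (Fin n)) :=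
  MonoidAlgebra.mapDomainAlgHom ℂ ℂ ((blockPerm β).comp (MonoidHom.inr _ _))

@[simp] theorem blockLeft_single (σ : Equiv.Perm (Fin k)) (z : ℂ) :
    blockLeft β (MonoidAlgebra.single σ z) = MonoidAlgebra.single (blockPerm β (σ, 1)) z := by
  simp [blockLeft]

@[simp] theorem blockRight_single (σ : Equiv.Perm (Fin k')) (z : ℂ) :
    blockRight β (MonoidAlgebra.single σ z) = MonoidAlgebra.single (blockPerm β (1, σ)) z := by
  simp [blockRight]

theorem blockLeft_mul_blockRight_single (σ : Equiv.Perm (Fin k)) (σ' : Equiv.Perm (Fin k'))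
    (z z' : ℂ) : blockLeft β (MonoidAlgebra.single σ z) * blockRight β (MonoidAlgebra.single σ' z') =
      MonoidAlgebra.single (blockPerm β (σ, σ')) (z * z') := by
  simp [MonoidAlgebra.single_mul_single, ← map_mul]

theorem blockRight_mul_blockLeft (a : MonoidAlgebra ℂ (Equiv.Perm (Fin k)))
    (b : MonoidAlgebra ℂ (Equiv.Perm (Fin k'))) :
    blockRight β b * blockLeft β a = blockLeft β a * blockRight β b := by
  induction a using MonoidAlgebra.induction_linear with
  | zero => simp
  | add x y hx hy => simp only [map_add, mul_add, add_mul, hx, hy]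
  | single σ z =>
    induction b using MonoidAlgebra.induction_linear with
    | zero => simp
    | add x y hx hy => simp only [map_add, mul_add, add_mul, hx, hy]
    | single τ w => simp [MonoidAlgebra.single_mul_single, ← map_mul, mul_comm]

-- Because `f''` takes different values on the two blocks, a permutation that preserves `f''` cannot
-- mix them, so the stabiliser is a product. This applies to columns but not to rows, since a row of
-- the sum may meet both blocks.
open Classical in
theorem stabSum_blockPerm {f : Fin k → ℕ} {f' : Fin k' → ℕ} {f'' : Fin n → ℕ}
    (hl : ∀ p q, f'' (β (.inl p)) = f'' (β (.inl q)) ↔ f p = f q)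
    (hr : ∀ p q, f'' (β (.inr p)) = f'' (β (.inr q)) ↔ f' p = f' q)
    (hne : ∀ p q, f'' (β (.inl p)) ≠ f'' (β (.inr q))) :
    stabSum Equiv.Perm.sign f'' =
      blockLeft β (stabSum Equiv.Perm.sign f) * blockRight β (stabSum Equiv.Perm.sign f') := by
  simp only [stabSum, map_sum, Finset.sum_mul_sum, blockLeft_mul_blockRight_single]
  rw [← Finset.sum_product']
  symm
  refine Finset.sum_bij (fun σ _ => blockPerm β σ) ?_ ?_ ?_ ?_
  · rintro ⟨σ, σ'⟩ h
    simp only [Finset.mem_product, Finset.mem_filter, Finset.mem_univ, true_and] at h ⊢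
    intro i
    obtain ⟨y, rfl⟩ := β.surjective i
    rcases y with y | y
    · rw [blockPerm_inl, hl]; exact h.1 y
    · rw [blockPerm_inr, hr]; exact h.2 y
  · rintro ⟨σ, σ'⟩ - ⟨τ, τ'⟩ - h
    refine Prod.ext (Equiv.ext fun p => ?_) (Equiv.ext fun p => ?_)
    · simpa using Equiv.congr_fun h (β (.inl p))
    · simpa using Equiv.congr_fun h (β (.inr p))
  · intro π hπ
    simp only [Finset.mem_filter, Finset.mem_univ, true_and] at hπ
    -- On a finite set, a permutation that maps the first block into itself also preserves the
    -- second.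
    have hmem : β.symm.permCongr π ∈ (Equiv.Perm.sumCongrHom (Fin k) (Fin k')).range := by
      apply Equiv.Perm.mem_sumCongrHom_range_of_perm_mapsTo_inl
      rintro _ ⟨p, rfl⟩
      rcases hx : β.symm (π (β (.inl p))) with q | q
      · exact ⟨q, by simp [Equiv.permCongr_apply, hx]⟩
      · have := hπ (β (.inl p))
        rw [Equiv.symm_apply_eq] at hx
        rw [hx] at this
        exact absurd this.symm (hne _ _)
    obtain ⟨⟨σ, σ'⟩, hσ⟩ := hmem
    have hπ' : blockPerm β (σ, σ') = π := by
      change β.permCongr (Equiv.Perm.sumCongrHom _ _ (σ, σ')) = π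
      rw [hσ]; ext; simp [Equiv.permCongr_apply]
    refine ⟨(σ, σ'), ?_, hπ'⟩
    subst hπ'
    simp only [Finset.mem_product, Finset.mem_filter, Finset.mem_univ, true_and]
    exact ⟨fun p => (hl _ _).1 (by simpa using hπ (β (.inl p))),
      fun p => (hr _ _).1 (by simpa using hπ (β (.inr p)))⟩
  · rintro ⟨σ, σ'⟩ -
    rw [sign_blockPerm]; simp

end

theorem YoungDiagram.IsBoxSum.colAntisymmetriser {lam lam' : YoungDiagram} {k k' n : ℕ}
    {h : lam.card = k} {h' : lam'.card = k'} {h'' : (lam + lam').card = n}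
    {β : Fin k ⊕ Fin k' ≃ Fin n} (H : IsBoxSum h h' h'' β) :
    (lam + lam').colAntisymmetriser h'' =
      blockLeft β (lam.colAntisymmetriser h) * blockRight β (lam'.colAntisymmetriser h') := by
  rw [colAntisymmetriser_eq, colAntisymmetriser_eq, colAntisymmetriser_eq]
  exact stabSum_blockPerm β H.col_inl H.col_inr H.col_ne

end

noncomputable section

/-! ### Intertwining maps as tensors -/

/-- If `ρ g` has the adjoint `ρ' g` for a nondegenerate form on `U`, then the intertwining maps
`U → W` correspond to the tensors in `U ⊗ W` on which `ρ' g ⊗ 1` and `1 ⊗ σ g` agree. -/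
theorem finrank_intertwiningMap_ne_zero_iff {G U W : Type*} [Group G] [AddCommGroup U] [Module ℂ U]
    [AddCommGroup W] [Module ℂ W] [Module.Finite ℂ U] [Module.Finite ℂ W]
    (ρ : Representation ℂ G U) (σ : Representation ℂ G W) (ρ' : G → U →ₗ[ℂ] U)
    (B : U →ₗ[ℂ] U →ₗ[ℂ] ℂ) (hB : ∀ g u v, B (ρ g u) v = B u (ρ' g v))
    (hnd : ∀ v, (∀ u, B u v = 0) → v = 0) :
    Module.finrank ℂ (Representation.IntertwiningMap ρ σ) ≠ 0 ↔
      ∃ z : U ⊗[ℂ] W, z ≠ 0 ∧ ∀ g,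
        TensorProduct.map (ρ' g) LinearMap.id z = TensorProduct.map LinearMap.id (σ g) z := by
  have hinj : Function.Injective B.flip := by
    rw [← LinearMap.ker_eq_bot, LinearMap.ker_eq_bot']
    intro v hv
    exact hnd v fun u => by simpa using LinearMap.congr_fun hv u
  -- Nondegeneracy gives an injection of `U` into its dual, which is bijective since the dimensions
  -- agree.
  let D : U ≃ₗ[ℂ] Module.Dual ℂ U :=
    LinearEquiv.ofInjectiveOfFinrankEq B.flip hinj Subspace.dual_finrank_eq.symm
  let E : U ⊗[ℂ] W ≃ₗ[ℂ] (U →ₗ[ℂ] W) :=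
    (TensorProduct.congr D (LinearEquiv.refl ℂ W)).trans
      (dualTensorHomEquiv ℂ U W)
  have hE : ∀ u w v, E (u ⊗ₜ w) v = B v u • w := fun u w v => by
    have hD : D u v = B v u := rfl
    simp [E, hD]
  have hE1 : ∀ g z, E (TensorProduct.map (ρ' g) LinearMap.id z) = E z ∘ₗ ρ g := by
    intro g z
    induction z using TensorProduct.induction_on with
    | zero => simp
    | add x y hx hy => simp only [map_add, hx, hy, LinearMap.add_comp]
    | tmul u w => ext v; simp [hE, hB]
  have hE2 : ∀ g z, E (TensorProduct.map LinearMap.id (σ g) z) = σ g ∘ₗ E z := by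
    intro g z
    induction z using TensorProduct.induction_on with
    | zero => simp
    | add x y hx hy => simp only [map_add, hx, hy, LinearMap.comp_add]
    | tmul u w => ext v; simp [hE]
  rw [← Nat.pos_iff_ne_zero, Module.finrank_pos_iff_exists_ne_zero]
  constructor
  · rintro ⟨φ, hφ⟩
    refine ⟨E.symm φ.toLinearMap, fun h => hφ ?_, fun g => E.injective ?_⟩
    · ext1
      simpa using h
    · rw [hE1, hE2, LinearEquiv.apply_symm_apply, φ.isIntertwining']
  · rintro ⟨z, hz, h⟩
    refine ⟨⟨E z, fun g => by rw [← hE1, ← hE2, h]⟩, fun h0 => hz (E.injective ?_)⟩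
    simpa using congrArg Representation.IntertwiningMap.toLinearMap h0

/-! ### Monomials of words -/

/-- Equal monomials mean that each letter occurs equally often in both words, and bijections between
the fibres glue to a permutation. -/
theorem exists_perm_of_prod_X_eq {k : ℕ} {X : Type*} {w w' : Fin k → X}
    (h : ∑ p, Finsupp.single (w p) 1 = ∑ p, (Finsupp.single (w' p) 1 : X →₀ ℕ)) :
    ∃ σ : Equiv.Perm (Fin k), ∀ p, w' (σ p) = w p := by
  classical
  have hc : ∀ x, Nonempty ({p // w p = x} ≃ {p // w' p = x}) := by
    intro x
    have := DFunLike.congr_fun h x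
    simp only [Finsupp.finsetSum_apply, Finsupp.single_apply, Finset.sum_boole, Nat.cast_id] at this
    exact ⟨Fintype.equivOfCardEq (by rw [Fintype.card_subtype, Fintype.card_subtype, this])⟩
  exact ⟨Equiv.ofFiberEquiv fun x => (hc x).some, fun p => Equiv.ofFiberEquiv_map _ p⟩

theorem exists_linearMap_monomial {ι X Y : Type*} [AddCommGroup Y] [Module ℂ Y]
    (m : ι → X →₀ ℕ) (q : ι → Y) (h : ∀ i j, m i = m j → q i = q j) :
    ∃ s : MvPolynomial X ℂ →ₗ[ℂ] Y, ∀ i, s (MvPolynomial.monomial (m i) 1) = q i := by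
  classical
  refine ⟨(MvPolynomial.basisMonomials X ℂ).constr ℂ
    -- The value 0 on the remaining monomials is arbitrary.
    fun μ => if h : ∃ i, m i = μ then q h.choose else 0, fun i => ?_⟩
  have hi : ∃ j, m j = m i := ⟨i, rfl⟩
  rw [← congrFun (MvPolynomial.coe_basisMonomials X ℂ) (m i), Module.Basis.constr_basis,
    dif_pos hi]
  exact h _ _ hi.choose_spec

theorem prod_X_eq_monomial {k : ℕ} {X : Type*} (w : Fin k → X) :
    ∏ p, (MvPolynomial.X (w p) : MvPolynomial X ℂ) =
      MvPolynomial.monomial (∑ p, Finsupp.single (w p) 1) 1 := by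
  simp [MvPolynomial.monomial_sum_one, MvPolynomial.X]

/-- This tensor product is the polynomial ring in the variables `X` with coefficients in the domain
`Q`. -/
theorem isDomain_tensor_mvPolynomial (Q X : Type*) [CommRing Q] [IsDomain Q] [Algebra ℂ Q] :
    IsDomain (MvPolynomial X ℂ ⊗[ℂ] Q) :=
  ((Algebra.TensorProduct.comm ℂ (MvPolynomial X ℂ) Q).toRingEquiv.toMulEquiv.trans
    (MvPolynomial.algebraTensorAlgEquiv (σ := X) ℂ Q).toRingEquiv.toMulEquiv).isDomain _

theorem tensor_mvPolynomial_mul_ne_zero {Q X : Type*} [CommRing Q] [IsDomain Q] [Algebra ℂ Q]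
    {P P' : MvPolynomial X ℂ ⊗[ℂ] Q} (hP : P ≠ 0) (hP' : P' ≠ 0) : P * P' ≠ 0 := by
  have := isDomain_tensor_mvPolynomial Q X
  exact mul_ne_zero hP hP'

theorem stabSum_mul_single {k : ℕ} (χ : Equiv.Perm (Fin k) →* ℤˣ) (f : Fin k → ℕ)
    (τ : Equiv.Perm (Fin k)) (hτ : ∀ i, f (τ i) = f i) :
    stabSum χ f * MonoidAlgebra.single τ (1 : ℂ) = ((χ τ : ℤ) : ℂ) • stabSum χ f := by
  have hi : ∀ i, f (τ⁻¹ i) = f i := fun i => by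
    rw [← hτ (τ⁻¹ i), ← Equiv.Perm.mul_apply, mul_inv_cancel, Equiv.Perm.one_apply]
  simpa only [groupInv_mul, groupInv_stabSum, groupInv_single, map_smul, inv_inv, map_inv,
    Int.units_inv_eq_self] using congrArg (groupInv k) (single_mul_stabSum χ f τ⁻¹ hi)

end

noncomputable section

/-! ### The polynomial model of `U_λ` -/

section
variable {d k : ℕ}

/-- The linear form `∑ i, v i * X (i, j)`. -/
def linForm (d j : ℕ) : (Fin d → ℂ) →ₗ[ℂ] MvPolynomial (Fin d × ℕ) ℂ :=
  Fintype.linearCombination ℂ fun i => MvPolynomial.X (i, j)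

theorem linForm_apply (j : ℕ) (v : Fin d → ℂ) :
    linForm d j v = ∑ i, v i • (MvPolynomial.X (i, j) : MvPolynomial (Fin d × ℕ) ℂ) := rfl

/-- The map `v₁ ⊗ ⋯ ⊗ v_k ↦ ∏ p, ∑ i, v_p(i) X (i, f p)`. -/
def rowPoly (d : ℕ) (f : Fin k → ℕ) : TensorPow d k →ₗ[ℂ] MvPolynomial (Fin d × ℕ) ℂ :=
  PiTensorProduct.lift ((MultilinearMap.mkPiAlgebra ℂ (Fin k) _).compLinearMap
    fun p => linForm d (f p))

@[simp] theorem rowPoly_tprod (f : Fin k → ℕ) (v : Fin k → Fin d → ℂ) :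
    rowPoly d f (PiTensorProduct.tprod ℂ v) = ∏ p, linForm d (f p) (v p) := by
  simp [rowPoly]

/-- The substitution by which matrices act on the polynomial ring. -/
def matPoly (M : Matrix (Fin d) (Fin d) ℂ) :
    MvPolynomial (Fin d × ℕ) ℂ →ₐ[ℂ] MvPolynomial (Fin d × ℕ) ℂ :=
  MvPolynomial.aeval fun x => linForm d x.2 (M.col x.1)

theorem matPoly_linForm (M : Matrix (Fin d) (Fin d) ℂ) (j : ℕ) (v : Fin d → ℂ) :
    matPoly M (linForm d j v) = linForm d j (Matrix.toLin' M v) := by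
  rw [linForm_apply, map_sum, Matrix.toLin'_apply, Matrix.mulVec_eq_sum, map_sum]
  refine Finset.sum_congr rfl fun i _ => ?_
  simp [matPoly, Matrix.col]

theorem rowPoly_tensorGL (f : Fin k → ℕ) (g : GL (Fin d) ℂ) (t : TensorPow d k) :
    rowPoly d f (tensorGL d k g t) = matPoly (g : Matrix (Fin d) (Fin d) ℂ) (rowPoly d f t) := by
  have : rowPoly d f ∘ₗ tensorGL d k g =
      (matPoly (g : Matrix (Fin d) (Fin d) ℂ)).toLinearMap ∘ₗ rowPoly d f := by
    refine PiTensorProduct.ext (MultilinearMap.ext fun v => ?_)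
    simp [tensorGL, matPoly_linForm, PiTensorProduct.map_tprod, map_prod]
  exact LinearMap.congr_fun this t

theorem tensorPerm_tprod (σ : Equiv.Perm (Fin k)) (v : Fin k → Fin d → ℂ) :
    tensorPerm d k σ (PiTensorProduct.tprod ℂ v) =
      PiTensorProduct.tprod ℂ fun p => v (σ⁻¹ p) :=
  PiTensorProduct.reindex_tprod _ _

/-- A row-preserving permutation only reorders the factors of a commutative product. -/
theorem rowPoly_tensorPerm (f : Fin k → ℕ) (σ : Equiv.Perm (Fin k)) (hσ : ∀ i, f (σ i) = f i)
    (t : TensorPow d k) : rowPoly d f (tensorPerm d k σ t) = rowPoly d f t := by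
  have : rowPoly d f ∘ₗ tensorPerm d k σ = rowPoly d f := by
    refine PiTensorProduct.ext (MultilinearMap.ext fun v => ?_)
    simp only [LinearMap.compMultilinearMap_apply, LinearMap.comp_apply, tensorPerm_tprod,
      rowPoly_tprod]
    rw [← Equiv.prod_comp σ]
    simp [hσ]
  exact LinearMap.congr_fun this t

theorem rowPoly_stabSum (f : Fin k → ℕ) (t : TensorPow d k) :
    rowPoly d f ((tensorPerm d k).asAlgebraHom (stabSum 1 f) t) =
      (stabCard f : ℂ) • rowPoly d f t := by
  classical
  rw [stabSum, map_sum, LinearMap.sum_apply, map_sum, Finset.sum_congr rfl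
    (g := fun _ => rowPoly d f t), Finset.sum_const, stabCard_eq, Nat.cast_smul_eq_nsmul]
  intro π hπ
  simp [Representation.asAlgebraHom_single, rowPoly_tensorPerm f π (by simpa using hπ)]

/-- The basis of the tensor power that consists of the tensors of basis vectors. -/
def wordBasis (d k : ℕ) : Module.Basis (Fin k → Fin d) ℂ (TensorPow d k) :=
  Basis.piTensorProduct fun _ => Pi.basisFun ℂ (Fin d)

theorem wordBasis_apply (w : Fin k → Fin d) :
    wordBasis d k w = PiTensorProduct.tprod ℂ fun p => Pi.single (w p) 1 := by
  simp [wordBasis]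

theorem wordBasis_repr_tprod (v : Fin k → Fin d → ℂ) (w : Fin k → Fin d) :
    (wordBasis d k).repr (PiTensorProduct.tprod ℂ v) w = ∏ p, v p (w p) := by
  simp [wordBasis]

theorem tensorPerm_wordBasis (σ : Equiv.Perm (Fin k)) (w : Fin k → Fin d) :
    tensorPerm d k σ (wordBasis d k w) = wordBasis d k fun p => w (σ⁻¹ p) := by
  rw [wordBasis_apply, tensorPerm_tprod, wordBasis_apply]

theorem rowPoly_wordBasis (f : Fin k → ℕ) (w : Fin k → Fin d) :
    rowPoly d f (wordBasis d k w) =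
      MvPolynomial.monomial (∑ p, Finsupp.single (w p, f p) 1) 1 := by
  rw [wordBasis_apply, rowPoly_tprod, ← prod_X_eq_monomial]
  refine Finset.prod_congr rfl fun p _ => ?_
  rw [linForm, Fintype.linearCombination_apply_single, one_smul]

/-- The kernel of `rowPoly d f` is killed by the symmetriser of `f`. -/
theorem exists_linearMap_rowPoly (d : ℕ) (f : Fin k → ℕ) :
    ∃ s : MvPolynomial (Fin d × ℕ) ℂ →ₗ[ℂ] TensorPow d k,
      ∀ t, s (rowPoly d f t) = (tensorPerm d k).asAlgebraHom (stabSum 1 f) t := by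
  obtain ⟨s, hs⟩ := exists_linearMap_monomial
    (fun w : Fin k → Fin d => ∑ p, Finsupp.single (w p, f p) 1)
    (fun w => (tensorPerm d k).asAlgebraHom (stabSum 1 f) (wordBasis d k w)) (by
      intro w w' h
      -- Two words with the same monomial differ by a permutation that preserves `f`, and the
      -- symmetriser of `f` absorbs it.
      obtain ⟨σ, hσ⟩ := exists_perm_of_prod_X_eq h
      simp only [Prod.mk.injEq] at hσ
      have hw : wordBasis d k w' = tensorPerm d k σ (wordBasis d k w) := by
        rw [tensorPerm_wordBasis]
        congr 1; ext1 p
        rw [← (hσ _).1, ← Equiv.Perm.mul_apply, mul_inv_cancel, Equiv.Perm.one_apply]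
      have h1 := stabSum_mul_single 1 f σ fun p => (hσ p).2
      simp only [MonoidHom.one_apply, Units.val_one, Int.cast_one, one_smul] at h1
      rw [hw, ← one_smul ℂ (tensorPerm d k σ), ← Representation.asAlgebraHom_single,
        ← Module.End.mul_apply, ← map_mul, h1])
  refine ⟨s, fun t => ?_⟩
  have : s ∘ₗ rowPoly d f = (tensorPerm d k).asAlgebraHom (stabSum 1 f) :=
    (wordBasis d k).ext fun w => by
      rw [LinearMap.comp_apply, rowPoly_wordBasis, hs]
  exact LinearMap.congr_fun this t

/-! ### The bilinear form on tensors -/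

/-- The symmetric bilinear form for which the words are orthonormal. -/
def tensorForm (d k : ℕ) : TensorPow d k →ₗ[ℂ] TensorPow d k →ₗ[ℂ] ℂ := (wordBasis d k).toDual

/-- Words are orthonormal, so adjointness says that the two matrices are transposes of each other.
-/
theorem tensorForm_ext {F F' : TensorPow d k →ₗ[ℂ] TensorPow d k}
    (h : ∀ w w', (wordBasis d k).repr (F (wordBasis d k w)) w' =
      (wordBasis d k).repr (F' (wordBasis d k w')) w) (t u : TensorPow d k) :
    tensorForm d k (F t) u = tensorForm d k t (F' u) := by
  have : tensorForm d k ∘ₗ F = (LinearMap.lcomp ℂ ℂ F') ∘ₗ tensorForm d k := by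
    refine (wordBasis d k).ext fun w => (wordBasis d k).ext fun w' => ?_
    simp only [LinearMap.comp_apply, LinearMap.lcomp_apply, tensorForm,
      Module.Basis.toDual_apply_left, Module.Basis.toDual_apply_right, h]
  exact LinearMap.congr_fun (LinearMap.congr_fun this t) u

/-- The transpose of an invertible matrix. -/
def glTranspose (g : GL (Fin d) ℂ) : GL (Fin d) ℂ :=
  ⟨(g : Matrix (Fin d) (Fin d) ℂ).transpose, (↑g⁻¹ : Matrix (Fin d) (Fin d) ℂ).transpose,
    by rw [← Matrix.transpose_mul, ← Units.val_mul]; simp,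
    by rw [← Matrix.transpose_mul, ← Units.val_mul]; simp⟩

theorem tensorForm_tensorGL (g : GL (Fin d) ℂ) (t t' : TensorPow d k) :
    tensorForm d k (tensorGL d k g t) t' = tensorForm d k t (tensorGL d k (glTranspose g) t') := by
  refine tensorForm_ext (fun w w' => ?_) t t'
  simp only [wordBasis_apply, tensorGL, MonoidHom.coe_mk, OneHom.coe_mk, PiTensorProduct.map_tprod,
    wordBasis_repr_tprod]
  refine Finset.prod_congr rfl fun p _ => ?_
  simp [glTranspose, Matrix.toLin'_apply]

theorem tensorForm_tensorPerm (σ : Equiv.Perm (Fin k)) (t t' : TensorPow d k) :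
    tensorForm d k (tensorPerm d k σ t) t' = tensorForm d k t (tensorPerm d k σ⁻¹ t') := by
  refine tensorForm_ext (fun w w' => ?_) t t'
  rw [wordBasis_apply, wordBasis_apply, tensorPerm_tprod, tensorPerm_tprod, wordBasis_repr_tprod,
    wordBasis_repr_tprod, ← Equiv.prod_comp σ]
  refine Finset.prod_congr rfl fun p _ => ?_
  simp [Pi.single_apply, eq_comm]

theorem tensorForm_stabSum (χ : Equiv.Perm (Fin k) →* ℤˣ) (f : Fin k → ℕ) (t t' : TensorPow d k) :
    tensorForm d k ((tensorPerm d k).asAlgebraHom (stabSum χ f) t) t' =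
      tensorForm d k t ((tensorPerm d k).asAlgebraHom (stabSum χ f) t') := by
  classical
  simp only [stabSum, map_sum, LinearMap.sum_apply, Representation.asAlgebraHom_single,
    LinearMap.smul_apply, map_smul, tensorForm_tensorPerm]
  rw [← sum_stab_inv]
  refine Finset.sum_congr rfl fun π _ => ?_
  rw [map_inv, Int.units_inv_eq_self, inv_inv]

theorem eq_zero_of_tensorForm {t : TensorPow d k} (h : ∀ t', tensorForm d k t' t = 0) : t = 0 := by
  refine (wordBasis d k).ext_elem fun w => ?_
  rw [← Module.Basis.toDual_apply_right]
  simpa [tensorForm] using h (wordBasis d k w)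

end
end

noncomputable section

/-! ### Littlewood–Richardson coefficients -/

section
variable {d k k' n : ℕ} (β : Fin k ⊕ Fin k' ≃ Fin n)

/-- Concatenation of tensors, with the factors arranged by `β`. -/
def tensorConcat (d : ℕ) : TensorPow d k →ₗ[ℂ] TensorPow d k' →ₗ[ℂ] TensorPow d n :=
  (TensorProduct.mk ℂ (TensorPow d k) (TensorPow d k')).compr₂
    ((PiTensorProduct.reindex ℂ (fun _ => Fin d → ℂ) β).toLinearMap ∘ₗ
      (PiTensorProduct.tmulEquiv ℂ (Fin d → ℂ)).toLinearMap)

theorem tensorConcat_tprod (v : Fin k → Fin d → ℂ) (v' : Fin k' → Fin d → ℂ) :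
    tensorConcat β d (PiTensorProduct.tprod ℂ v) (PiTensorProduct.tprod ℂ v') =
      PiTensorProduct.tprod ℂ fun p => Sum.elim v v' (β.symm p) := by
  simp only [tensorConcat, LinearMap.compr₂_apply, TensorProduct.mk_apply, LinearMap.comp_apply,
    LinearEquiv.coe_coe, PiTensorProduct.tmulEquiv_apply]
  exact PiTensorProduct.reindex_tprod _ _

theorem linearMap_tprod_ext₂ {M : Type*} [AddCommGroup M] [Module ℂ M]
    {F F' : TensorPow d k →ₗ[ℂ] TensorPow d k' →ₗ[ℂ] M}
    (h : ∀ v v', F (PiTensorProduct.tprod ℂ v) (PiTensorProduct.tprod ℂ v') =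
      F' (PiTensorProduct.tprod ℂ v) (PiTensorProduct.tprod ℂ v')) : F = F' :=
  PiTensorProduct.ext (MultilinearMap.ext fun v =>
    PiTensorProduct.ext (MultilinearMap.ext fun v' => h v v'))

theorem tensorConcat_tensorPerm (σ : Equiv.Perm (Fin k) × Equiv.Perm (Fin k')) (t : TensorPow d k)
    (t' : TensorPow d k') :
    tensorConcat β d (tensorPerm d k σ.1 t) (tensorPerm d k' σ.2 t') =
      tensorPerm d n (blockPerm β σ) (tensorConcat β d t t') := by
  have : (tensorConcat β d).compl₁₂ (tensorPerm d k σ.1) (tensorPerm d k' σ.2) =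
      (tensorConcat β d).compr₂ (tensorPerm d n (blockPerm β σ)) := by
    refine linearMap_tprod_ext₂ fun v v' => ?_
    simp only [LinearMap.compl₁₂_apply, LinearMap.compr₂_apply, tensorPerm_tprod,
      tensorConcat_tprod]
    congr 1
    ext1 p
    obtain ⟨y, rfl⟩ := β.surjective p
    rw [← map_inv]
    rcases y with y | y
    · rw [blockPerm_inl, Equiv.symm_apply_apply, Equiv.symm_apply_apply]; rfl
    · rw [blockPerm_inr, Equiv.symm_apply_apply, Equiv.symm_apply_apply]; rfl
  exact LinearMap.congr_fun₂ this t t'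

theorem tensorConcat_blockLeft (a : MonoidAlgebra ℂ (Equiv.Perm (Fin k))) (t : TensorPow d k)
    (t' : TensorPow d k') :
    tensorConcat β d ((tensorPerm d k).asAlgebraHom a t) t' =
      (tensorPerm d n).asAlgebraHom (blockLeft β a) (tensorConcat β d t t') := by
  induction a using MonoidAlgebra.induction_linear with
  | zero => simp
  | add x y hx hy => simp [hx, hy]
  | single σ z =>
    have := tensorConcat_tensorPerm β (σ, 1) t t'
    simp only [map_one, Module.End.one_apply] at this
    simp [Representation.asAlgebraHom_single, this]

theorem tensorConcat_blockRight (a : MonoidAlgebra ℂ (Equiv.Perm (Fin k'))) (t : TensorPow d k)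
    (t' : TensorPow d k') :
    tensorConcat β d t ((tensorPerm d k').asAlgebraHom a t') =
      (tensorPerm d n).asAlgebraHom (blockRight β a) (tensorConcat β d t t') := by
  induction a using MonoidAlgebra.induction_linear with
  | zero => simp
  | add x y hx hy => simp [hx, hy]
  | single σ z =>
    have := tensorConcat_tensorPerm β (1, σ) t t'
    simp only [map_one, Module.End.one_apply] at this
    simp [Representation.asAlgebraHom_single, this]

theorem rowPoly_tensorConcat {f : Fin k → ℕ} {f' : Fin k' → ℕ} {f'' : Fin n → ℕ}
    (hl : ∀ p, f'' (β (.inl p)) = f p) (hr : ∀ p, f'' (β (.inr p)) = f' p)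
    (t : TensorPow d k) (t' : TensorPow d k') :
    rowPoly d f'' (tensorConcat β d t t') = rowPoly d f t * rowPoly d f' t' := by
  have : (tensorConcat β d).compr₂ (rowPoly d f'') =
      (LinearMap.mul ℂ _).compl₁₂ (rowPoly d f) (rowPoly d f') := by
    refine linearMap_tprod_ext₂ fun v v' => ?_
    simp only [LinearMap.compr₂_apply, LinearMap.compl₁₂_apply, tensorConcat_tprod,
      rowPoly_tprod, LinearMap.mul_apply']
    rw [← Equiv.prod_comp β, Fintype.prod_sum_type]
    simp [hl, hr]
  exact LinearMap.congr_fun₂ this t t'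

end

/-! ### Polynomial models of `U_λ` and their products. -/

instance weylSpaceAddCommGroup (d : ℕ) (lam : YoungDiagram) : AddCommGroup (weylSpace d lam) :=
  Module.addCommMonoidToAddCommGroup ℂ

/-- The polynomial model of `U_λ`, in which highest weight vectors are products of minors. -/
def weylPoly (d : ℕ) (lam : YoungDiagram) : weylSpace d lam →ₗ[ℂ] MvPolynomial (Fin d × ℕ) ℂ :=
  rowPoly d (fun i => (lam.box rfl i).1) ∘ₗ (weylSpace d lam).subtype

theorem mem_weylSpace_iff {d : ℕ} {lam : YoungDiagram} {u : TensorPow d lam.card} :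
    u ∈ weylSpace d lam ↔ ∃ t, (tensorPerm d _).asAlgebraHom (lam.rowSymmetriser rfl)
      ((tensorPerm d _).asAlgebraHom (lam.colAntisymmetriser rfl) t) = u := by
  simp only [weylSpace, YoungDiagram.symmetriser, map_mul, LinearMap.mem_range,
    Module.End.mul_apply]

/-- An element of `U_λ` has the form `r·t`, and its polynomial is a nonzero multiple of that of `t`.
If this vanishes, then so does `r·t`, which depends only on the polynomial of `t`. -/
theorem weylPoly_injective (d : ℕ) (lam : YoungDiagram) : Function.Injective (weylPoly d lam) := by
  rw [← LinearMap.ker_eq_bot, LinearMap.ker_eq_bot']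
  rintro ⟨u, hu⟩ h
  obtain ⟨t, rfl⟩ := mem_weylSpace_iff.1 hu
  ext1
  simp only [weylPoly, LinearMap.comp_apply, Submodule.subtype_apply,
    YoungDiagram.rowSymmetriser_eq] at h ⊢
  rw [rowPoly_stabSum, smul_eq_zero] at h
  obtain ⟨s, hs⟩ := exists_linearMap_rowPoly d (fun i => (lam.box rfl i).1)
  rw [← hs, h.resolve_left (Nat.cast_ne_zero.mpr (stabCard_ne_zero _)), map_zero]
  rfl

/-- The row symmetriser is removed at the cost of the nonzero scalar `N`. This matters because,
unlike the column antisymmetriser, it does not factor over blocks. -/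
theorem mem_range_weylPoly_iff {d : ℕ} {lam : YoungDiagram} {P : MvPolynomial (Fin d × ℕ) ℂ} :
    P ∈ LinearMap.range (weylPoly d lam) ↔ ∃ t, rowPoly d (fun i => (lam.box rfl i).1)
      ((tensorPerm d _).asAlgebraHom (lam.colAntisymmetriser rfl) t) = P := by
  set N : ℂ := (stabCard fun i => (lam.box rfl i).1 : ℂ) with hN
  have hN0 : N ≠ 0 := Nat.cast_ne_zero.mpr (stabCard_ne_zero _)
  constructor
  · rintro ⟨⟨u, hu⟩, rfl⟩
    obtain ⟨t, rfl⟩ := mem_weylSpace_iff.1 hu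
    refine ⟨N • t, ?_⟩
    simp only [weylPoly, LinearMap.comp_apply, Submodule.subtype_apply,
      YoungDiagram.rowSymmetriser_eq]
    rw [rowPoly_stabSum, map_smul, map_smul]
  · rintro ⟨t, rfl⟩
    refine ⟨⟨_, mem_weylSpace_iff.2 ⟨N⁻¹ • t, rfl⟩⟩, ?_⟩
    simp only [weylPoly, LinearMap.comp_apply, Submodule.subtype_apply,
      YoungDiagram.rowSymmetriser_eq]
    rw [rowPoly_stabSum, map_smul, map_smul, smul_smul, mul_inv_cancel₀ hN0, one_smul]

/-- Multiplying polynomials is concatenating tensors along a bijection of boxes that keeps rows, and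
the column antisymmetriser of the sum acts on each factor separately. -/
theorem weylPoly_mul_mem {d : ℕ} {lam lam' : YoungDiagram} {P P' : MvPolynomial (Fin d × ℕ) ℂ}
    (hP : P ∈ LinearMap.range (weylPoly d lam)) (hP' : P' ∈ LinearMap.range (weylPoly d lam')) :
    P * P' ∈ LinearMap.range (weylPoly d (lam + lam')) := by
  obtain ⟨t, rfl⟩ := mem_range_weylPoly_iff.1 hP
  obtain ⟨t', rfl⟩ := mem_range_weylPoly_iff.1 hP'
  obtain ⟨β, hβ⟩ := YoungDiagram.exists_isBoxSum (lam := lam) (lam' := lam') rfl rfl rfl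
  refine mem_range_weylPoly_iff.2 ⟨tensorConcat β d t t', ?_⟩
  rw [hβ.colAntisymmetriser, map_mul, Module.End.mul_apply, ← tensorConcat_blockRight,
    ← tensorConcat_blockLeft, rowPoly_tensorConcat β hβ.row_inl hβ.row_inr]

theorem weylPoly_weylRep {d : ℕ} {lam : YoungDiagram} (g : GL (Fin d) ℂ) (u : weylSpace d lam) :
    weylPoly d lam (weylRep d lam g u) =
      matPoly (g : Matrix (Fin d) (Fin d) ℂ) (weylPoly d lam u) :=
  rowPoly_tensorGL _ g _

/-- If `v = rc·t` is orthogonal to all `rc·t'`, self-adjointness gives `crrc·t = 0`, hence `crc·t =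
0`. As `rc` is a left multiple of `crc`, `v` vanishes. -/
theorem eq_zero_of_tensorForm_weylSpace {d : ℕ} {lam : YoungDiagram} (v : weylSpace d lam)
    (h : ∀ u : weylSpace d lam, tensorForm d lam.card u v = 0) : v = 0 := by
  obtain ⟨v, hv⟩ := v
  obtain ⟨t, rfl⟩ := mem_weylSpace_iff.1 hv
  ext1
  have h0 : ∀ t', tensorForm d _ t' ((tensorPerm d _).asAlgebraHom (lam.colAntisymmetriser rfl)
      ((tensorPerm d _).asAlgebraHom (lam.rowSymmetriser rfl)
      ((tensorPerm d _).asAlgebraHom (lam.rowSymmetriser rfl)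
      ((tensorPerm d _).asAlgebraHom (lam.colAntisymmetriser rfl) t)))) = 0 := by
    intro t'
    have := h ⟨_, mem_weylSpace_iff.2 ⟨t', rfl⟩⟩
    simp only [YoungDiagram.rowSymmetriser_eq, YoungDiagram.colAntisymmetriser_eq] at this ⊢
    rwa [tensorForm_stabSum, tensorForm_stabSum] at this
  have h1 := eq_zero_of_tensorForm h0
  simp only [← Module.End.mul_apply, ← map_mul, YoungDiagram.rowSymmetriser_eq,
    YoungDiagram.colAntisymmetriser_eq, ZeroMemClass.coe_zero] at h1 ⊢
  obtain ⟨b, hb⟩ := exists_stabSum_mul_eq_left 1 (fun i => (lam.box rfl i).1) Equiv.Perm.sign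
    (fun i => (lam.box rfl i).2)
  rw [← mul_assoc (stabSum 1 _), stabSum_mul_self, smul_mul_assoc,
    mul_smul_comm, map_smul, LinearMap.smul_apply, smul_eq_zero] at h1
  rw [hb, mul_assoc, mul_assoc, map_mul, Module.End.mul_apply,
    h1.resolve_left (Nat.cast_ne_zero.mpr (stabCard_ne_zero _)), map_zero]

theorem tensorForm_weylRep {d : ℕ} {lam : YoungDiagram} (g : GL (Fin d) ℂ) (u v : weylSpace d lam) :
    tensorForm d lam.card (weylRep d lam g u : weylSpace d lam) v =
      tensorForm d lam.card u (weylRep d lam (glTranspose g) v : weylSpace d lam) :=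
  tensorForm_tensorGL g (u : TensorPow d lam.card) v

/-- The restriction of the bilinear form on tensors to `U_λ`. -/
def weylForm (d : ℕ) (lam : YoungDiagram) : weylSpace d lam →ₗ[ℂ] weylSpace d lam →ₗ[ℂ] ℂ :=
  (tensorForm d lam.card).compl₁₂ (weylSpace d lam).subtype (weylSpace d lam).subtype

theorem weylForm_apply {d : ℕ} {lam : YoungDiagram} (u v : weylSpace d lam) :
    weylForm d lam u v = tensorForm d lam.card u v := rfl

/-- The ring of polynomial functions of three matrices. -/
abbrev TriplePoly (d : ℕ) : Type :=
  MvPolynomial (Fin d × ℕ) ℂ ⊗[ℂ] (MvPolynomial (Fin d × ℕ) ℂ ⊗[ℂ] MvPolynomial (Fin d × ℕ) ℂ)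

theorem triplePoly_mul_ne_zero {d : ℕ} {P Q : TriplePoly d} (hP : P ≠ 0) (hQ : Q ≠ 0) :
    P * Q ≠ 0 := by
  have := isDomain_tensor_mvPolynomial (MvPolynomial (Fin d × ℕ) ℂ) (Fin d × ℕ)
  exact tensor_mvPolynomial_mul_ne_zero hP hQ

/-- The polynomial model of `U_λ ⊗ (U_μ ⊗ U_ν)`. -/
def weylTriple (d : ℕ) (lam μ ν : YoungDiagram) :
    weylSpace d lam ⊗[ℂ] (weylSpace d μ ⊗[ℂ] weylSpace d ν) →ₗ[ℂ] TriplePoly d :=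
  TensorProduct.map (weylPoly d lam) (TensorProduct.map (weylPoly d μ) (weylPoly d ν))

theorem weylTriple_injective (d : ℕ) (lam μ ν : YoungDiagram) :
    Function.Injective (weylTriple d lam μ ν) :=
  TensorProduct.map_injective_of_flat_flat _ _ (weylPoly_injective d lam)
    (TensorProduct.map_injective_of_flat_flat _ _ (weylPoly_injective d μ) (weylPoly_injective d ν))

/-- Products of tensors whose components multiply into given subspaces. -/
theorem tensor_mul_mem_range {A A' M M' M'' N N' N'' : Type*} [CommRing A] [Algebra ℂ A] [CommRing A']
    [Algebra ℂ A'] [AddCommGroup M] [Module ℂ M] [AddCommGroup M'] [Module ℂ M'] [AddCommGroup M'']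
    [Module ℂ M''] [AddCommGroup N] [Module ℂ N] [AddCommGroup N'] [Module ℂ N'] [AddCommGroup N'']
    [Module ℂ N''] {f : M →ₗ[ℂ] A} {f' : M' →ₗ[ℂ] A} {f'' : M'' →ₗ[ℂ] A}
    {g : N →ₗ[ℂ] A'} {g' : N' →ₗ[ℂ] A'} {g'' : N'' →ₗ[ℂ] A'}
    (hf : ∀ x x', f x * f' x' ∈ LinearMap.range f'')
    (hg : ∀ x x', g x * g' x' ∈ LinearMap.range g'') (z : M ⊗[ℂ] N) (z' : M' ⊗[ℂ] N') :
    TensorProduct.map f g z * TensorProduct.map f' g' z' ∈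
      LinearMap.range (TensorProduct.map f'' g'') := by
  induction z using TensorProduct.induction_on with
  | zero => simp
  | add x y hx hy => rw [map_add, add_mul]; exact add_mem hx hy
  | tmul x y =>
    induction z' using TensorProduct.induction_on with
    | zero => simp
    | add x' y' hx hy => rw [map_add, mul_add]; exact add_mem hx hy
    | tmul x' y' =>
      obtain ⟨u, hu⟩ := hf x x'
      obtain ⟨v, hv⟩ := hg y y'
      exact ⟨u ⊗ₜ v, by simp [hu, hv]⟩

theorem weylTriple_mul_mem {d : ℕ} {lam μ ν lam' μ' ν' : YoungDiagram}
    (z : weylSpace d lam ⊗[ℂ] (weylSpace d μ ⊗[ℂ] weylSpace d ν))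
    (z' : weylSpace d lam' ⊗[ℂ] (weylSpace d μ' ⊗[ℂ] weylSpace d ν')) :
    weylTriple d lam μ ν z * weylTriple d lam' μ' ν' z' ∈
      LinearMap.range (weylTriple d (lam + lam') (μ + μ') (ν + ν')) :=
  tensor_mul_mem_range (fun x x' => weylPoly_mul_mem ⟨x, rfl⟩ ⟨x', rfl⟩)
    (tensor_mul_mem_range (fun x x' => weylPoly_mul_mem ⟨x, rfl⟩ ⟨x', rfl⟩)
      (fun x x' => weylPoly_mul_mem ⟨x, rfl⟩ ⟨x', rfl⟩)) z z'

theorem weylTriple_map_left {d : ℕ} {lam μ ν : YoungDiagram} (g : GL (Fin d) ℂ)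
    (z : weylSpace d lam ⊗[ℂ] (weylSpace d μ ⊗[ℂ] weylSpace d ν)) :
    weylTriple d lam μ ν (TensorProduct.map (weylRep d lam g) LinearMap.id z) =
      Algebra.TensorProduct.map (matPoly (g : Matrix (Fin d) (Fin d) ℂ)) (AlgHom.id ℂ _)
        (weylTriple d lam μ ν z) := by
  induction z using TensorProduct.induction_on with
  | zero => simp
  | add x y hx hy => simp only [map_add, hx, hy]
  | tmul x y => simp [weylTriple, weylPoly_weylRep]

theorem weylTriple_map_right {d : ℕ} {lam μ ν : YoungDiagram} (g : GL (Fin d) ℂ)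
    (z : weylSpace d lam ⊗[ℂ] (weylSpace d μ ⊗[ℂ] weylSpace d ν)) :
    weylTriple d lam μ ν
        (TensorProduct.map LinearMap.id (((weylRep d μ).tprod (weylRep d ν)) g) z) =
      Algebra.TensorProduct.map (AlgHom.id ℂ _)
        (Algebra.TensorProduct.map (matPoly (g : Matrix (Fin d) (Fin d) ℂ))
          (matPoly (g : Matrix (Fin d) (Fin d) ℂ))) (weylTriple d lam μ ν z) := by
  induction z using TensorProduct.induction_on with
  | zero => simp
  | add x y hx hy => simp only [map_add, hx, hy]
  | tmul x y =>
    induction y using TensorProduct.induction_on with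
    | zero => simp
    | add x y hx hy => simp only [TensorProduct.tmul_add, map_add, hx, hy]
    | tmul y y' => simp [weylTriple, weylPoly_weylRep]

/-- The adjoint of `g` on `U_λ` is its transpose, so invariance becomes an equation between two
algebra homomorphisms evaluated at `P`, a condition that is stable under multiplication. -/
theorem littlewoodRichardson_ne_zero_iff {d : ℕ} {μ ν lam : YoungDiagram} :
    littlewoodRichardson d μ ν lam ≠ 0 ↔
      ∃ P ∈ LinearMap.range (weylTriple d lam μ ν), P ≠ 0 ∧ ∀ g : GL (Fin d) ℂ,
        Algebra.TensorProduct.map (matPoly (glTranspose g : Matrix (Fin d) (Fin d) ℂ))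
          (AlgHom.id ℂ _) P =
        Algebra.TensorProduct.map (AlgHom.id ℂ _)
          (Algebra.TensorProduct.map (matPoly (g : Matrix (Fin d) (Fin d) ℂ))
            (matPoly (g : Matrix (Fin d) (Fin d) ℂ))) P := by
  have : Module.Finite ℂ (TensorPow d lam.card) := .of_basis (wordBasis d lam.card)
  have : Module.Finite ℂ (TensorPow d μ.card) := .of_basis (wordBasis d μ.card)
  have : Module.Finite ℂ (TensorPow d ν.card) := .of_basis (wordBasis d ν.card)
  have hB : ∀ (g : GL (Fin d) ℂ) (u v : weylSpace d lam), weylForm d lam (weylRep d lam g u) v =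
      weylForm d lam u (weylRep d lam (glTranspose g) v) := fun g u v => by
    rw [weylForm_apply, weylForm_apply, tensorForm_weylRep]
  have hnd : ∀ v : weylSpace d lam, (∀ u, weylForm d lam u v = 0) → v = 0 :=
    fun v h => eq_zero_of_tensorForm_weylSpace v fun u => h u
  rw [littlewoodRichardson, finrank_intertwiningMap_ne_zero_iff (weylRep d lam)
    ((weylRep d μ).tprod (weylRep d ν)) (fun g => weylRep d lam (glTranspose g)) (weylForm d lam)
    hB hnd]
  constructor
  · rintro ⟨z, hz, h⟩
    refine ⟨_, ⟨z, rfl⟩, (map_ne_zero_iff _ (weylTriple_injective d lam μ ν)).2 hz, fun g => ?_⟩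
    rw [← weylTriple_map_left, ← weylTriple_map_right, h]
  · rintro ⟨_, ⟨z, rfl⟩, hz, h⟩
    refine ⟨z, (map_ne_zero_iff _ (weylTriple_injective d lam μ ν)).1 hz, fun g => ?_⟩
    apply weylTriple_injective
    rw [weylTriple_map_left, weylTriple_map_right, h]

theorem littlewoodRichardson_add_ne_zero {d : ℕ} {μ ν lam μ' ν' lam' : YoungDiagram}
    (h : littlewoodRichardson d μ ν lam ≠ 0) (h' : littlewoodRichardson d μ' ν' lam' ≠ 0) :
    littlewoodRichardson d (μ + μ') (ν + ν') (lam + lam') ≠ 0 := by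
  rw [littlewoodRichardson_ne_zero_iff] at h h' ⊢
  obtain ⟨_, ⟨z, rfl⟩, hz, hg⟩ := h
  obtain ⟨_, ⟨z', rfl⟩, hz', hg'⟩ := h'
  exact ⟨_, weylTriple_mul_mem z z', triplePoly_mul_ne_zero hz hz', fun g => by
    rw [map_mul, map_mul, hg, hg']⟩

end

noncomputable section

/-! ### Kronecker coefficients -/

/-- The group algebra of `S_k`. -/
abbrev PermAlg (k : ℕ) : Type := MonoidAlgebra ℂ (Equiv.Perm (Fin k))

/-- Three-fold tensors over the group algebra of `S_k`. -/
abbrev PermTriple (k : ℕ) : Type := PermAlg k ⊗[ℂ] (PermAlg k ⊗[ℂ] PermAlg k)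

/-- The basis of permutations. -/
def permBasis (k : ℕ) : Module.Basis (Equiv.Perm (Fin k)) ℂ (PermAlg k) :=
  MonoidAlgebra.basis _ ℂ

theorem permBasis_apply {k : ℕ} (σ : Equiv.Perm (Fin k)) :
    permBasis k σ = MonoidAlgebra.single σ 1 := rfl

theorem permTriple_ext {k : ℕ} {M : Type*} [AddCommGroup M] [Module ℂ M]
    {F F' : PermTriple k →ₗ[ℂ] M}
    (h : ∀ σ τ ρ : Equiv.Perm (Fin k), F (MonoidAlgebra.single σ 1 ⊗ₜ
      (MonoidAlgebra.single τ 1 ⊗ₜ MonoidAlgebra.single ρ 1)) = F' (MonoidAlgebra.single σ 1 ⊗ₜ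
      (MonoidAlgebra.single τ 1 ⊗ₜ MonoidAlgebra.single ρ 1))) : F = F' := by
  refine ((permBasis k).tensorProduct ((permBasis k).tensorProduct (permBasis k))).ext ?_
  rintro ⟨σ, τ, ρ⟩
  simpa only [Module.Basis.tensorProduct_apply, permBasis_apply] using h σ τ ρ

section
variable {k : ℕ} (f f₁ f₂ f₃ : Fin k → ℕ)

/-- The orbit map `σ ↦ f ∘ σ⁻¹` into the span of words. -/
def wordMap : PermAlg k →ₗ[ℂ] ((Fin k → ℕ) →₀ ℂ) :=
  Finsupp.lmapDomain ℂ ℂ (fun (σ : Equiv.Perm (Fin k)) p => f (σ⁻¹ p)) ∘ₗ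
    (MonoidAlgebra.coeffLinearEquiv ℂ).toLinearMap

theorem wordMap_single (σ : Equiv.Perm (Fin k)) (z : ℂ) :
    wordMap f (MonoidAlgebra.single σ z) = Finsupp.single (fun p => f (σ⁻¹ p)) z := by
  simp [wordMap, MonoidAlgebra.coeffLinearEquiv]

/-- Right multiplication by the symmetriser of `f`, up to its order, is invisible in words. -/
theorem wordMap_mulRight_stabSum :
    wordMap f ∘ₗ LinearMap.mulRight ℂ (stabSum 1 f) = (stabCard f : ℂ) • wordMap f := by
  classical
  refine (permBasis k).ext fun σ => ?_
  rw [permBasis_apply]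
  simp only [LinearMap.comp_apply, LinearMap.mulRight_apply, LinearMap.smul_apply, stabSum,
    Finset.mul_sum, map_sum, MonoidAlgebra.single_mul_single, wordMap_single]
  rw [Finset.sum_congr rfl (g := fun _ => Finsupp.single (fun p => f (σ⁻¹ p)) 1),
    Finset.sum_const, stabCard_eq, Nat.cast_smul_eq_nsmul]
  intro π hπ
  simp only [Finset.mem_filter, Finset.mem_univ, true_and] at hπ
  simp only [MonoidHom.one_apply, Units.val_one, Int.cast_one, mul_one]
  congr 1
  ext p
  rw [← hπ ((σ * π)⁻¹ p), mul_inv_rev, ← Equiv.Perm.mul_apply, mul_inv_cancel_left]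

/-- The span of the words of length `k`. -/
abbrev WordSpan (k : ℕ) : Type := (Fin k → ℕ) →₀ ℂ

/-- The basis of triples of words. -/
def wordTripleBasis (k : ℕ) : Module.Basis ((Fin k → ℕ) × (Fin k → ℕ) × (Fin k → ℕ)) ℂ
    (WordSpan k ⊗[ℂ] (WordSpan k ⊗[ℂ] WordSpan k)) :=
  Finsupp.basisSingleOne.tensorProduct
    (Finsupp.basisSingleOne.tensorProduct Finsupp.basisSingleOne)

/-- The polynomial of a triple of words. -/
def wordPoly (k : ℕ) :
    WordSpan k ⊗[ℂ] (WordSpan k ⊗[ℂ] WordSpan k) →ₗ[ℂ] MvPolynomial (ℕ × ℕ × ℕ) ℂ :=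
  (wordTripleBasis k).constr ℂ
    fun w => MvPolynomial.monomial (∑ p, Finsupp.single (w.1 p, w.2.1 p, w.2.2 p) 1) 1

theorem wordPoly_single (w₁ w₂ w₃ : Fin k → ℕ) :
    wordPoly k (Finsupp.single w₁ 1 ⊗ₜ (Finsupp.single w₂ 1 ⊗ₜ Finsupp.single w₃ 1)) =
      MvPolynomial.monomial (∑ p, Finsupp.single (w₁ p, w₂ p, w₃ p) 1) 1 := by
  have h : wordTripleBasis k (w₁, w₂, w₃) =
      Finsupp.single w₁ 1 ⊗ₜ (Finsupp.single w₂ 1 ⊗ₜ Finsupp.single w₃ 1) := by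
    simp only [wordTripleBasis, Module.Basis.tensorProduct_apply, Finsupp.coe_basisSingleOne]
  rw [← h, wordPoly, Module.Basis.constr_basis]

/-- The polynomial of a triple of permutations, acting on the words `f₁`, `f₂`, `f₃`. -/
def triplePoly : PermTriple k →ₗ[ℂ] MvPolynomial (ℕ × ℕ × ℕ) ℂ :=
  wordPoly k ∘ₗ TensorProduct.map (wordMap f₁) (TensorProduct.map (wordMap f₂) (wordMap f₃))

theorem triplePoly_single (σ τ ρ : Equiv.Perm (Fin k)) :
    triplePoly f₁ f₂ f₃ (MonoidAlgebra.single σ 1 ⊗ₜ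
      (MonoidAlgebra.single τ 1 ⊗ₜ MonoidAlgebra.single ρ 1)) =
      MvPolynomial.monomial
        (∑ p, Finsupp.single (f₁ (σ⁻¹ p), f₂ (τ⁻¹ p), f₃ (ρ⁻¹ p)) 1) 1 := by
  simp only [triplePoly, LinearMap.comp_apply, TensorProduct.map_tmul, wordMap_single,
    wordPoly_single]

/-- Slotwise right multiplication. -/
def mulRight₃ (a₁ a₂ a₃ : PermAlg k) : PermTriple k →ₗ[ℂ] PermTriple k :=
  TensorProduct.map (LinearMap.mulRight ℂ a₁)
    (TensorProduct.map (LinearMap.mulRight ℂ a₂) (LinearMap.mulRight ℂ a₃))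

/-- The diagonal action of `S_k` by left multiplication. -/
def diagLeft (π : Equiv.Perm (Fin k)) : PermTriple k →ₗ[ℂ] PermTriple k :=
  TensorProduct.map (LinearMap.mulLeft ℂ (MonoidAlgebra.single π 1))
    (TensorProduct.map (LinearMap.mulLeft ℂ (MonoidAlgebra.single π 1))
      (LinearMap.mulLeft ℂ (MonoidAlgebra.single π 1)))

theorem mulRight₃_mul (a₁ a₂ a₃ b₁ b₂ b₃ : PermAlg k) :
    mulRight₃ (a₁ * b₁) (a₂ * b₂) (a₃ * b₃) = mulRight₃ b₁ b₂ b₃ ∘ₗ mulRight₃ a₁ a₂ a₃ := by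
  simp only [mulRight₃, ← TensorProduct.map_comp, LinearMap.mulRight_mul]

theorem diagLeft_mulRight₃ (π : Equiv.Perm (Fin k)) (a₁ a₂ a₃ : PermAlg k) (z : PermTriple k) :
    diagLeft π (mulRight₃ a₁ a₂ a₃ z) = mulRight₃ a₁ a₂ a₃ (diagLeft π z) := by
  have : diagLeft π ∘ₗ mulRight₃ a₁ a₂ a₃ = mulRight₃ a₁ a₂ a₃ ∘ₗ diagLeft π := by
    refine permTriple_ext fun σ τ ρ => ?_
    simp only [LinearMap.comp_apply, diagLeft, mulRight₃, TensorProduct.map_tmul,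
      LinearMap.mulLeft_apply, LinearMap.mulRight_apply, mul_assoc]
  exact LinearMap.congr_fun this z

theorem triplePoly_mulRight₃ (z : PermTriple k) :
    triplePoly f₁ f₂ f₃ (mulRight₃ (stabSum 1 f₁) (stabSum 1 f₂) (stabSum 1 f₃) z) =
      ((stabCard f₁ : ℂ) * (stabCard f₂ * stabCard f₃)) • triplePoly f₁ f₂ f₃ z := by
  have : triplePoly f₁ f₂ f₃ ∘ₗ mulRight₃ (stabSum 1 f₁) (stabSum 1 f₂) (stabSum 1 f₃) =
      ((stabCard f₁ : ℂ) * (stabCard f₂ * stabCard f₃)) • triplePoly f₁ f₂ f₃ := by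
    simp only [triplePoly, mulRight₃, LinearMap.comp_assoc, ← TensorProduct.map_comp,
      wordMap_mulRight_stabSum, TensorProduct.map_smul_left, TensorProduct.map_smul_right,
      LinearMap.comp_smul, smul_smul]
    congr 1
    ring
  exact LinearMap.congr_fun this z

/-- Acting by the same `π` in all three slots moves the positions simultaneously, so it only
reorders the factors of the monomial. -/
theorem triplePoly_diagLeft (π : Equiv.Perm (Fin k)) (z : PermTriple k) :
    triplePoly f₁ f₂ f₃ (diagLeft π z) = triplePoly f₁ f₂ f₃ z := by
  have : triplePoly f₁ f₂ f₃ ∘ₗ diagLeft π = triplePoly f₁ f₂ f₃ := by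
    refine permTriple_ext fun σ τ ρ => ?_
    simp only [LinearMap.comp_apply, diagLeft, TensorProduct.map_tmul, LinearMap.mulLeft_apply,
      MonoidAlgebra.single_mul_single, mul_one, triplePoly_single]
    rw [← Equiv.sum_comp π]
    simp
  exact LinearMap.congr_fun this z

/-- The kernel of `triplePoly` is killed by symmetrisation. -/
theorem exists_linearMap_triplePoly :
    ∃ s : MvPolynomial (ℕ × ℕ × ℕ) ℂ →ₗ[ℂ] PermTriple k, ∀ z, s (triplePoly f₁ f₂ f₃ z) =
      ∑ π, diagLeft π (mulRight₃ (stabSum 1 f₁) (stabSum 1 f₂) (stabSum 1 f₃) z) := by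
  have hr : ∀ (f : Fin k → ℕ) (σ σ' κ : Equiv.Perm (Fin k)),
      (∀ p, f (σ'⁻¹ (κ p)) = f (σ⁻¹ p)) →
      MonoidAlgebra.single (κ * σ) (1 : ℂ) * stabSum 1 f =
        MonoidAlgebra.single σ' (1 : ℂ) * stabSum 1 f := by
    intro f σ σ' κ h
    have h1 := single_mul_stabSum 1 f (σ'⁻¹ * (κ * σ)) fun p => by
      simpa using h (σ p)
    simp only [MonoidHom.one_apply, Units.val_one, Int.cast_one, one_smul] at h1
    conv_rhs => rw [← h1, ← mul_assoc, MonoidAlgebra.single_mul_single, mul_inv_cancel_left,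
      mul_one]
  obtain ⟨s, hs⟩ := exists_linearMap_monomial
    (fun w : Equiv.Perm (Fin k) × Equiv.Perm (Fin k) × Equiv.Perm (Fin k) =>
      ∑ p, Finsupp.single (f₁ (w.1⁻¹ p), f₂ (w.2.1⁻¹ p), f₃ (w.2.2⁻¹ p)) 1)
    (fun w => ∑ π, diagLeft π (mulRight₃ (stabSum 1 f₁) (stabSum 1 f₂) (stabSum 1 f₃)
      (MonoidAlgebra.single w.1 1 ⊗ₜ (MonoidAlgebra.single w.2.1 1 ⊗ₜ
        MonoidAlgebra.single w.2.2 1)))) (by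
      rintro ⟨σ, τ, ρ⟩ ⟨σ', τ', ρ'⟩ h
      -- One permutation `κ` of the positions serves all three slots. The sum over `π` absorbs `κ`,
      -- and in each slot the stabiliser sum absorbs the remaining difference `σ'⁻¹ κ σ` (see `hr`).
      obtain ⟨κ, hκ⟩ := exists_perm_of_prod_X_eq h
      simp only [Prod.mk.injEq] at hκ
      rw [← Equiv.sum_comp (Equiv.mulRight κ)]
      refine Finset.sum_congr rfl fun π _ => ?_
      simp only [diagLeft, mulRight₃, TensorProduct.map_tmul, LinearMap.mulRight_apply,
        LinearMap.mulLeft_apply, Equiv.coe_mulRight,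
        ← hr f₁ σ σ' κ fun p => (hκ p).1, ← hr f₂ τ τ' κ fun p => (hκ p).2.1,
        ← hr f₃ ρ ρ' κ fun p => (hκ p).2.2, ← mul_assoc, MonoidAlgebra.single_mul_single, mul_one])
  refine ⟨s, fun z => ?_⟩
  have : s ∘ₗ triplePoly f₁ f₂ f₃ = (∑ π, diagLeft π) ∘ₗ
      mulRight₃ (stabSum 1 f₁) (stabSum 1 f₂) (stabSum 1 f₃) := by
    refine permTriple_ext fun σ τ ρ => ?_
    rw [LinearMap.comp_apply, triplePoly_single, hs (σ, τ, ρ), LinearMap.comp_apply,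
      LinearMap.sum_apply]
  simpa using LinearMap.congr_fun this z

/-! ### The bilinear form on the group algebra -/

/-- The symmetric bilinear form for which the permutations are orthonormal. -/
def permForm (k : ℕ) : PermAlg k →ₗ[ℂ] PermAlg k →ₗ[ℂ] ℂ := (permBasis k).toDual

theorem permForm_ext {F F' : PermAlg k →ₗ[ℂ] PermAlg k}
    (h : ∀ σ τ, (F (MonoidAlgebra.single σ 1)).coeff τ = (F' (MonoidAlgebra.single τ 1)).coeff σ)
    (x y : PermAlg k) : permForm k (F x) y = permForm k x (F' y) := by
  have : permForm k ∘ₗ F = (LinearMap.lcomp ℂ ℂ F') ∘ₗ permForm k := by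
    refine (permBasis k).ext fun σ => (permBasis k).ext fun τ => ?_
    simp only [LinearMap.comp_apply, LinearMap.lcomp_apply, permForm,
      Module.Basis.toDual_apply_left, Module.Basis.toDual_apply_right]
    exact h σ τ
  exact LinearMap.congr_fun₂ this x y

theorem permForm_single_mul (π : Equiv.Perm (Fin k)) (x y : PermAlg k) :
    permForm k (MonoidAlgebra.single π 1 * x) y =
      permForm k x (MonoidAlgebra.single π⁻¹ 1 * y) := by
  classical
  refine permForm_ext (F := LinearMap.mulLeft ℂ (MonoidAlgebra.single π 1))
    (F' := LinearMap.mulLeft ℂ (MonoidAlgebra.single π⁻¹ 1)) (fun σ τ => ?_) x y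
  simp only [LinearMap.mulLeft_apply, MonoidAlgebra.single_mul_single, mul_one,
    MonoidAlgebra.coeff_single, Finsupp.single_apply, inv_mul_eq_iff_eq_mul]
  exact if_congr eq_comm rfl rfl

theorem permForm_mul_single (π : Equiv.Perm (Fin k)) (x y : PermAlg k) :
    permForm k (x * MonoidAlgebra.single π 1) y =
      permForm k x (y * MonoidAlgebra.single π⁻¹ 1) := by
  classical
  refine permForm_ext (F := LinearMap.mulRight ℂ (MonoidAlgebra.single π 1))
    (F' := LinearMap.mulRight ℂ (MonoidAlgebra.single π⁻¹ 1)) (fun σ τ => ?_) x y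
  simp only [LinearMap.mulRight_apply, MonoidAlgebra.single_mul_single, mul_one,
    MonoidAlgebra.coeff_single, Finsupp.single_apply, mul_inv_eq_iff_eq_mul]
  exact if_congr eq_comm rfl rfl

theorem permForm_mul_stabSum (χ : Equiv.Perm (Fin k) →* ℤˣ) (x y : PermAlg k) :
    permForm k (x * stabSum χ f) y = permForm k x (y * stabSum χ f) := by
  classical
  have hs : ∀ (π : Equiv.Perm (Fin k)) (z : ℂ), MonoidAlgebra.single π z =
      z • MonoidAlgebra.single π (1 : ℂ) := fun π z => by
    rw [MonoidAlgebra.smul_single, smul_eq_mul, mul_one]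
  simp only [stabSum, Finset.mul_sum, map_sum, LinearMap.sum_apply]
  rw [← sum_stab_inv]
  refine Finset.sum_congr rfl fun π _ => ?_
  rw [map_inv, Int.units_inv_eq_self, hs π⁻¹, hs π, mul_smul_comm, mul_smul_comm, map_smul,
    map_smul, LinearMap.smul_apply, permForm_mul_single, inv_inv]

theorem eq_zero_of_permForm {x : PermAlg k} (h : ∀ y, permForm k y x = 0) : x = 0 := by
  refine (permBasis k).ext_elem fun σ => ?_
  rw [← Module.Basis.toDual_apply_right]
  simpa [permForm] using h (permBasis k σ)

end
end

/-! ### Specht modules and the nonvanishing criterion for Kronecker coefficients. -/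

noncomputable section

instance spechtSpaceAddCommGroup {k : ℕ} (lam : YoungDiagram) (hl : lam.card = k) :
    AddCommGroup (spechtSpace lam hl) :=
  Module.addCommMonoidToAddCommGroup ℂ

section
variable {k : ℕ} {lam μ ν : YoungDiagram} (hl : lam.card = k) (hm : μ.card = k) (hn : ν.card = k)

theorem mem_spechtSpace_iff {x : PermAlg k} : x ∈ spechtSpace lam hl ↔
    ∃ a, a * (lam.rowSymmetriser hl * lam.colAntisymmetriser hl) = x := by
  simp only [spechtSpace, YoungDiagram.symmetriser, LinearMap.mem_range, LinearMap.mulRight_apply]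

/-- Right multiplication by the Young symmetriser, as a map onto `V_λ`. -/
def toSpecht : PermAlg k →ₗ[ℂ] spechtSpace lam hl :=
  LinearMap.codRestrict _ (LinearMap.mulRight ℂ (lam.symmetriser hl)) fun x => ⟨x, rfl⟩

theorem subtype_comp_toSpecht :
    (spechtSpace lam hl).subtype ∘ₗ toSpecht hl = LinearMap.mulRight ℂ (lam.symmetriser hl) := rfl

theorem coe_spechtRep (π : Equiv.Perm (Fin k)) (x : spechtSpace lam hl) :
    (spechtRep lam hl π x : PermAlg k) = MonoidAlgebra.single π 1 * (x : PermAlg k) :=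
  leftRegular_apply_eq_mul π (x : PermAlg k)

/-- Since `rc` is a right multiple of `rcr`, an element `a·rc` is recovered from `a·rcr`. -/
theorem eq_zero_of_mul_rowSymmetriser {x : PermAlg k} (hx : x ∈ spechtSpace lam hl)
    (h : x * lam.rowSymmetriser hl = 0) : x = 0 := by
  obtain ⟨a, rfl⟩ := (mem_spechtSpace_iff hl).1 hx
  obtain ⟨b, hb⟩ := exists_stabSum_mul_eq_right 1 (fun i => (lam.box hl i).1) Equiv.Perm.sign
    (fun i => (lam.box hl i).2)
  rw [YoungDiagram.rowSymmetriser_eq, YoungDiagram.colAntisymmetriser_eq] at h ⊢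
  rw [hb, ← mul_assoc, ← mul_assoc, h, zero_mul]

theorem mulRight_rowSymmetriser_injective : Function.Injective
    (LinearMap.mulRight ℂ (lam.rowSymmetriser hl) ∘ₗ (spechtSpace lam hl).subtype) := by
  rw [← LinearMap.ker_eq_bot, LinearMap.ker_eq_bot']
  rintro ⟨x, hx⟩ h
  exact Subtype.ext (eq_zero_of_mul_rowSymmetriser hl hx h)

/-- The restriction of the bilinear form on the group algebra to `V_λ`. -/
def spechtForm : spechtSpace lam hl →ₗ[ℂ] spechtSpace lam hl →ₗ[ℂ] ℂ :=
  (permForm k).compl₁₂ (spechtSpace lam hl).subtype (spechtSpace lam hl).subtype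

theorem spechtForm_apply (x y : spechtSpace lam hl) :
    spechtForm hl x y = permForm k x y := rfl

theorem spechtForm_spechtRep (π : Equiv.Perm (Fin k)) (x y : spechtSpace lam hl) :
    spechtForm hl (spechtRep lam hl π x) y = spechtForm hl x (spechtRep lam hl π⁻¹ y) := by
  rw [spechtForm_apply, spechtForm_apply, coe_spechtRep, coe_spechtRep, permForm_single_mul]

/-- Orthogonality of `y` to all `x·rc` means `y·cr = 0`. For `y` in `V_λ`, `y·c` is a nonzero
multiple of `y`, so `y·r = 0`. -/
theorem eq_zero_of_spechtForm (y : spechtSpace lam hl) (h : ∀ x, spechtForm hl x y = 0) :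
    y = 0 := by
  obtain ⟨y, hy⟩ := y
  refine Subtype.ext (eq_zero_of_mul_rowSymmetriser hl hy ?_)
  have h0 : ∀ x, permForm k x (y * lam.colAntisymmetriser hl * lam.rowSymmetriser hl) = 0 := by
    intro x
    have : permForm k (x * (lam.rowSymmetriser hl * lam.colAntisymmetriser hl)) y = 0 :=
      h ⟨_, (mem_spechtSpace_iff hl).2 ⟨x, rfl⟩⟩
    rwa [← mul_assoc, YoungDiagram.rowSymmetriser_eq,
      YoungDiagram.colAntisymmetriser_eq, permForm_mul_stabSum, permForm_mul_stabSum,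
      ← YoungDiagram.rowSymmetriser_eq, ← YoungDiagram.colAntisymmetriser_eq] at this
  have h1 := eq_zero_of_permForm h0
  obtain ⟨a, rfl⟩ := (mem_spechtSpace_iff hl).1 hy
  change a * (lam.rowSymmetriser hl * lam.colAntisymmetriser hl) * lam.rowSymmetriser hl = 0
  rw [YoungDiagram.colAntisymmetriser_eq] at h1 ⊢
  rw [mul_assoc a, mul_assoc (lam.rowSymmetriser hl), stabSum_mul_self, mul_smul_comm,
    mul_smul_comm, smul_mul_assoc, smul_eq_zero] at h1
  exact h1.resolve_left (Nat.cast_ne_zero.mpr (stabCard_ne_zero _))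

/-- The inclusion of `V_λ ⊗ (V_μ ⊗ V_ν)` into the triple tensors over the group algebra. -/
def spechtTriple : spechtSpace lam hl ⊗[ℂ] (spechtSpace μ hm ⊗[ℂ] spechtSpace ν hn) →ₗ[ℂ]
    PermTriple k :=
  TensorProduct.map (spechtSpace lam hl).subtype
    (TensorProduct.map (spechtSpace μ hm).subtype (spechtSpace ν hn).subtype)

theorem spechtTriple_tprod (π : Equiv.Perm (Fin k))
    (z : spechtSpace lam hl ⊗[ℂ] (spechtSpace μ hm ⊗[ℂ] spechtSpace ν hn)) :
    spechtTriple hl hm hn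
      (((spechtRep lam hl).tprod ((spechtRep μ hm).tprod (spechtRep ν hn))) π z) =
      diagLeft π (spechtTriple hl hm hn z) := by
  induction z using TensorProduct.induction_on with
  | zero => simp
  | add x y hx hy => simp only [map_add, hx, hy]
  | tmul x y =>
    induction y using TensorProduct.induction_on with
    | zero => simp
    | add x y hx hy => simp only [TensorProduct.tmul_add, map_add, hx, hy]
    | tmul y y' => simp [spechtTriple, diagLeft, coe_spechtRep]

theorem mulRight₃_spechtTriple_injective : Function.Injective
    (mulRight₃ (lam.rowSymmetriser hl) (μ.rowSymmetriser hm) (ν.rowSymmetriser hn) ∘ₗ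
      spechtTriple hl hm hn) := by
  rw [mulRight₃, spechtTriple, ← TensorProduct.map_comp, ← TensorProduct.map_comp]
  exact TensorProduct.map_injective_of_flat_flat _ _ (mulRight_rowSymmetriser_injective hl)
    (TensorProduct.map_injective_of_flat_flat _ _ (mulRight_rowSymmetriser_injective hm)
      (mulRight_rowSymmetriser_injective hn))

/-- The polynomial of a triple of permutations of the boxes of three diagrams. -/
def rowTriplePoly : PermTriple k →ₗ[ℂ] MvPolynomial (ℕ × ℕ × ℕ) ℂ :=
  triplePoly (fun i => (lam.box hl i).1) (fun i => (μ.box hm i).1) (fun i => (ν.box hn i).1)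

theorem rowTriplePoly_mulRight₃_eq_zero {z : PermTriple k} :
    rowTriplePoly hl hm hn
      (mulRight₃ (lam.rowSymmetriser hl) (μ.rowSymmetriser hm) (ν.rowSymmetriser hn) z) = 0 ↔
    rowTriplePoly hl hm hn z = 0 := by
  rw [YoungDiagram.rowSymmetriser_eq, YoungDiagram.rowSymmetriser_eq,
    YoungDiagram.rowSymmetriser_eq, rowTriplePoly, triplePoly_mulRight₃, smul_eq_zero,
    or_iff_right]
  simp [stabCard_ne_zero]

/-- The form makes `V_λ` self-dual, so intertwining maps are diagonal invariants. A nonzero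
invariant with zero polynomial is impossible, since symmetrising it only multiplies by `k!` and
right multiplication by the row symmetrisers is injective. Conversely, averaging a tensor multiplies
its polynomial by `k!`. -/
theorem finrank_spechtRep_ne_zero_iff :
    Module.finrank ℂ (Representation.IntertwiningMap (spechtRep lam hl)
      ((spechtRep μ hm).tprod (spechtRep ν hn))) ≠ 0 ↔
      ∃ z, rowTriplePoly hl hm hn (spechtTriple hl hm hn z) ≠ 0 := by
  refine (finrank_intertwiningMap_ne_zero_iff (spechtRep lam hl)
    ((spechtRep μ hm).tprod (spechtRep ν hn)) (fun π => spechtRep lam hl π⁻¹) (spechtForm hl)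
    (spechtForm_spechtRep hl) (eq_zero_of_spechtForm hl)).trans ?_
  set D := (spechtRep lam hl).tprod ((spechtRep μ hm).tprod (spechtRep ν hn)) with hD
  have hl1 : ∀ (π : Equiv.Perm (Fin k)) (z), D π z =
      TensorProduct.map (spechtRep lam hl π) LinearMap.id (TensorProduct.map LinearMap.id
        (((spechtRep μ hm).tprod (spechtRep ν hn)) π) z) := fun π z => by
    rw [← LinearMap.comp_apply, ← TensorProduct.map_comp]; rfl
  have hl2 : ∀ (π : Equiv.Perm (Fin k))
      (z : spechtSpace lam hl ⊗[ℂ] (spechtSpace μ hm ⊗[ℂ] spechtSpace ν hn)),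
      TensorProduct.map (spechtRep lam hl π) LinearMap.id
        (TensorProduct.map (spechtRep lam hl π⁻¹) LinearMap.id z) = z := fun π z => by
    rw [← LinearMap.comp_apply, ← TensorProduct.map_comp, ← Module.End.mul_eq_comp, ← map_mul,
      mul_inv_cancel, map_one]
    simp [Module.End.one_eq_id]
  have hcard : (Fintype.card (Equiv.Perm (Fin k)) : ℂ) ≠ 0 :=
    Nat.cast_ne_zero.mpr Fintype.card_ne_zero
  constructor
  · rintro ⟨z, hz, h⟩
    refine ⟨z, fun h0 => hz (mulRight₃_spechtTriple_injective hl hm hn ?_)⟩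
    have hinv : ∀ π, diagLeft π (spechtTriple hl hm hn z) = spechtTriple hl hm hn z := fun π => by
      rw [← spechtTriple_tprod, ← hD, hl1, ← h, hl2]
    obtain ⟨s, hs⟩ := exists_linearMap_triplePoly (fun i => (lam.box hl i).1)
      (fun i => (μ.box hm i).1) (fun i => (ν.box hn i).1)
    have h1 := hs (spechtTriple hl hm hn z)
    simp only [diagLeft_mulRight₃, hinv, Finset.sum_const, Finset.card_univ] at h1
    rw [show triplePoly _ _ _ (spechtTriple hl hm hn z) = 0 from h0, map_zero,
      ← Nat.cast_smul_eq_nsmul ℂ, eq_comm, smul_eq_zero] at h1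
    rw [map_zero, LinearMap.comp_apply, YoungDiagram.rowSymmetriser_eq,
      YoungDiagram.rowSymmetriser_eq, YoungDiagram.rowSymmetriser_eq]
    exact h1.resolve_left hcard
  · rintro ⟨z, hz⟩
    have hinv : ∀ π, D π (∑ τ, D τ z) = ∑ τ, D τ z := fun π => by
      rw [map_sum, ← Equiv.sum_comp (Equiv.mulLeft π) fun τ => D τ z]
      simp
    refine ⟨∑ π, D π z, fun h0 => hz ?_, fun π => ?_⟩
    · have h1 := congrArg (fun x => rowTriplePoly hl hm hn (spechtTriple hl hm hn x)) h0
      simp only [map_sum, map_zero, hD, spechtTriple_tprod, rowTriplePoly, triplePoly_diagLeft,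
        Finset.sum_const, Finset.card_univ] at h1
      rw [← Nat.cast_smul_eq_nsmul ℂ, smul_eq_zero] at h1
      exact h1.resolve_left hcard
    · conv_lhs => rw [← hinv π, hl1]
      have := hl2 π⁻¹ (TensorProduct.map LinearMap.id
        (((spechtRep μ hm).tprod (spechtRep ν hn)) π) (∑ τ, D τ z))
      rwa [inv_inv] at this

/-- In the nonvanishing criterion, the row symmetrisers can be dropped. -/
theorem exists_rowTriplePoly_ne_zero_iff :
    (∃ z, rowTriplePoly hl hm hn (spechtTriple hl hm hn z) ≠ 0) ↔
      ∃ z, rowTriplePoly hl hm hn (mulRight₃ (lam.colAntisymmetriser hl)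
        (μ.colAntisymmetriser hm) (ν.colAntisymmetriser hn) z) ≠ 0 := by
  constructor
  · rintro ⟨z, hz⟩
    by_contra! h
    refine hz ?_
    have hmem : ∀ z, ∃ z', spechtTriple hl hm hn z = mulRight₃ (lam.colAntisymmetriser hl)
        (μ.colAntisymmetriser hm) (ν.colAntisymmetriser hn) z' := by
      intro z
      induction z using TensorProduct.induction_on with
      | zero => exact ⟨0, by simp⟩
      | add x y hx hy =>
        obtain ⟨x', hx⟩ := hx
        obtain ⟨y', hy⟩ := hy
        exact ⟨x' + y', by rw [map_add, map_add, hx, hy]⟩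
      | tmul x y =>
        induction y using TensorProduct.induction_on with
        | zero => exact ⟨0, by simp⟩
        | add u v hu hv =>
          obtain ⟨u', hu⟩ := hu
          obtain ⟨v', hv⟩ := hv
          exact ⟨u' + v', by rw [TensorProduct.tmul_add, map_add, map_add, hu, hv]⟩
        | tmul y w =>
          obtain ⟨x, hx⟩ := x
          obtain ⟨y, hy⟩ := y
          obtain ⟨w, hw⟩ := w
          obtain ⟨a, rfl⟩ := (mem_spechtSpace_iff hl).1 hx
          obtain ⟨b, rfl⟩ := (mem_spechtSpace_iff hm).1 hy
          obtain ⟨c, rfl⟩ := (mem_spechtSpace_iff hn).1 hw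
          exact ⟨(a * lam.rowSymmetriser hl) ⊗ₜ
            ((b * μ.rowSymmetriser hm) ⊗ₜ (c * ν.rowSymmetriser hn)),
            by simp [spechtTriple, mulRight₃, mul_assoc]⟩
    obtain ⟨z', hz'⟩ := hmem z
    rw [hz', h]
  · rintro ⟨z, hz⟩
    by_contra! h
    refine hz ?_
    -- With `cr = b·rcr`, a tensor in `A·c` can be multiplied by `r`, rewritten as `b·rcr`, and
    -- stripped of the last `r`. The polynomial only changes by nonzero scalars, and what is left
    -- lies in `A·rc`.
    have hkey : ∀ {lam : YoungDiagram} (hl : lam.card = k),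
        ∃ b, lam.colAntisymmetriser hl * lam.rowSymmetriser hl =
          b * (lam.rowSymmetriser hl * lam.colAntisymmetriser hl) * lam.rowSymmetriser hl := by
      intro lam hl
      obtain ⟨b, hb⟩ := exists_stabSum_mul_eq_left Equiv.Perm.sign (fun i => (lam.box hl i).2) 1
        (fun i => (lam.box hl i).1)
      refine ⟨b, ?_⟩
      rw [YoungDiagram.rowSymmetriser_eq, YoungDiagram.colAntisymmetriser_eq, hb]
      simp only [mul_assoc]
    obtain ⟨b₁, h₁⟩ := hkey hl
    obtain ⟨b₂, h₂⟩ := hkey hm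
    obtain ⟨b₃, h₃⟩ := hkey hn
    rw [← rowTriplePoly_mulRight₃_eq_zero, ← LinearMap.comp_apply (mulRight₃ _ _ _),
      ← mulRight₃_mul, h₁, h₂, h₃, mulRight₃_mul, LinearMap.comp_apply,
      rowTriplePoly_mulRight₃_eq_zero]
    have hfac : ∀ z, ∃ z', mulRight₃ (b₁ * (lam.rowSymmetriser hl * lam.colAntisymmetriser hl))
        (b₂ * (μ.rowSymmetriser hm * μ.colAntisymmetriser hm))
        (b₃ * (ν.rowSymmetriser hn * ν.colAntisymmetriser hn)) z =
        spechtTriple hl hm hn z' := by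
      intro z
      refine ⟨TensorProduct.map
        (toSpecht hl ∘ₗ LinearMap.mulRight ℂ b₁)
        (TensorProduct.map (toSpecht hm ∘ₗ LinearMap.mulRight ℂ b₂)
        (toSpecht hn ∘ₗ LinearMap.mulRight ℂ b₃)) z, ?_⟩
      rw [spechtTriple, ← LinearMap.comp_apply, ← TensorProduct.map_comp,
        ← TensorProduct.map_comp, mulRight₃, ← LinearMap.comp_assoc, ← LinearMap.comp_assoc,
        ← LinearMap.comp_assoc, subtype_comp_toSpecht, subtype_comp_toSpecht,
        subtype_comp_toSpecht, ← LinearMap.mulRight_mul, ← LinearMap.mulRight_mul,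
        ← LinearMap.mulRight_mul]
      rfl
    obtain ⟨z', hz'⟩ := hfac z
    rw [hz', h]

end

/-! ### Multiplicativity -/

theorem map₂_map {M M' M'' N N' N'' : Type*} [AddCommGroup M] [Module ℂ M] [AddCommGroup M']
    [Module ℂ M'] [AddCommGroup M''] [Module ℂ M''] [AddCommGroup N] [Module ℂ N]
    [AddCommGroup N'] [Module ℂ N'] [AddCommGroup N''] [Module ℂ N'']
    {J : M →ₗ[ℂ] M' →ₗ[ℂ] M''} {K : N →ₗ[ℂ] N' →ₗ[ℂ] N''}
    {F : M →ₗ[ℂ] M} {F' : M' →ₗ[ℂ] M'} {F'' : M'' →ₗ[ℂ] M''}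
    {G : N →ₗ[ℂ] N} {G' : N' →ₗ[ℂ] N'} {G'' : N'' →ₗ[ℂ] N''}
    (hJ : ∀ x x', J (F x) (F' x') = F'' (J x x')) (hK : ∀ x x', K (G x) (G' x') = G'' (K x x'))
    (z : M ⊗[ℂ] N) (z' : M' ⊗[ℂ] N') :
    TensorProduct.map₂ J K (TensorProduct.map F G z) (TensorProduct.map F' G' z') =
      TensorProduct.map F'' G'' (TensorProduct.map₂ J K z z') := by
  induction z using TensorProduct.induction_on with
  | zero => simp
  | add x y hx hy => simp only [map_add, LinearMap.add_apply, hx, hy]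
  | tmul x y =>
    induction z' using TensorProduct.induction_on with
    | zero => simp
    | add x' y' hx hy => simp only [map_add, hx, hy]
    | tmul x' y' => simp [hJ, hK]

section
variable {k k' n : ℕ} (γ β β₁ β₂ β₃ : Fin k ⊕ Fin k' ≃ Fin n)

/-- The bilinear extension of `(σ, σ') ↦ γ (σ ⊕ σ') β⁻¹`. -/
def permConcat : PermAlg k →ₗ[ℂ] PermAlg k' →ₗ[ℂ] PermAlg n :=
  ((LinearMap.mul ℂ (PermAlg n)).compl₁₂ (blockLeft β).toLinearMap
    (blockRight β).toLinearMap).compr₂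
      (LinearMap.mulLeft ℂ (MonoidAlgebra.single (β.symm.trans γ) 1))

theorem permConcat_apply (x : PermAlg k) (x' : PermAlg k') :
    permConcat γ β x x' =
      MonoidAlgebra.single (β.symm.trans γ) 1 * (blockLeft β x * blockRight β x') := rfl

theorem permConcat_single (σ : Equiv.Perm (Fin k)) (σ' : Equiv.Perm (Fin k')) :
    permConcat γ β (MonoidAlgebra.single σ 1) (MonoidAlgebra.single σ' 1) =
      MonoidAlgebra.single ((β.symm.trans γ) * blockPerm β (σ, σ')) 1 := by
  rw [permConcat_apply, blockLeft_mul_blockRight_single, MonoidAlgebra.single_mul_single, mul_one,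
    mul_one]

/-- Right multiplication passes through because the two blocks commute and the twist by `γ` acts
from the left. -/
theorem permConcat_mul (x a : PermAlg k) (x' a' : PermAlg k') :
    permConcat γ β (x * a) (x' * a') =
      permConcat γ β x x' * (blockLeft β a * blockRight β a') := by
  simp only [permConcat_apply, map_mul, mul_assoc]
  rw [← mul_assoc (blockLeft β a), ← blockRight_mul_blockLeft]
  simp only [mul_assoc]

theorem permConcat_inv_inl (f : Fin k → ℕ) (f'' : Fin n → ℕ)
    (hl : ∀ p, f'' (β (.inl p)) = f p) (σ : Equiv.Perm (Fin k)) (σ' : Equiv.Perm (Fin k'))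
    (p : Fin k) : f'' (((β.symm.trans γ) * blockPerm β (σ, σ') : Equiv.Perm _)⁻¹ (γ (.inl p))) =
      f (σ⁻¹ p) := by
  rw [← hl]
  congr 1
  rw [Equiv.Perm.inv_eq_iff_eq, Equiv.Perm.mul_apply, blockPerm_inl]
  simp

theorem permConcat_inv_inr (f' : Fin k' → ℕ) (f'' : Fin n → ℕ)
    (hr : ∀ p, f'' (β (.inr p)) = f' p) (σ : Equiv.Perm (Fin k)) (σ' : Equiv.Perm (Fin k'))
    (p : Fin k') : f'' (((β.symm.trans γ) * blockPerm β (σ, σ') : Equiv.Perm _)⁻¹ (γ (.inr p))) =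
      f' (σ'⁻¹ p) := by
  rw [← hr]
  congr 1
  rw [Equiv.Perm.inv_eq_iff_eq, Equiv.Perm.mul_apply, blockPerm_inr]
  simp

/-- Slotwise concatenation of triples of permutations. -/
def permConcat₃ : PermTriple k →ₗ[ℂ] PermTriple k' →ₗ[ℂ] PermTriple n :=
  TensorProduct.map₂ (permConcat γ β₁) (TensorProduct.map₂ (permConcat γ β₂) (permConcat γ β₃))

/-- The common `γ` splits the positions into two blocks for all three slots at once, so the monomial
is a product. The `β`s may differ, as they only match boxes within a slot. -/
theorem triplePoly_permConcat₃ {f₁ f₂ f₃ : Fin k → ℕ} {f₁' f₂' f₃' : Fin k' → ℕ}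
    {f₁'' f₂'' f₃'' : Fin n → ℕ}
    (hl₁ : ∀ p, f₁'' (β₁ (.inl p)) = f₁ p) (hr₁ : ∀ p, f₁'' (β₁ (.inr p)) = f₁' p)
    (hl₂ : ∀ p, f₂'' (β₂ (.inl p)) = f₂ p) (hr₂ : ∀ p, f₂'' (β₂ (.inr p)) = f₂' p)
    (hl₃ : ∀ p, f₃'' (β₃ (.inl p)) = f₃ p) (hr₃ : ∀ p, f₃'' (β₃ (.inr p)) = f₃' p)
    (z : PermTriple k) (z' : PermTriple k') :
    triplePoly f₁'' f₂'' f₃'' (permConcat₃ γ β₁ β₂ β₃ z z') =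
      triplePoly f₁ f₂ f₃ z * triplePoly f₁' f₂' f₃' z' := by
  have : (permConcat₃ γ β₁ β₂ β₃).compr₂ (triplePoly f₁'' f₂'' f₃'') =
      (LinearMap.mul ℂ _).compl₁₂ (triplePoly f₁ f₂ f₃) (triplePoly f₁' f₂' f₃') := by
    refine permTriple_ext fun σ τ ρ => permTriple_ext fun σ' τ' ρ' => ?_
    simp only [LinearMap.compr₂_apply, LinearMap.compl₁₂_apply, permConcat₃,
      TensorProduct.map₂_apply_tmul, TensorProduct.map_tmul, permConcat_single,
      triplePoly_single, LinearMap.mul_apply', MvPolynomial.monomial_mul, mul_one]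
    rw [← Equiv.sum_comp γ, Fintype.sum_sum_type]
    simp only [permConcat_inv_inl γ β₁ f₁ f₁'' hl₁, permConcat_inv_inl γ β₂ f₂ f₂'' hl₂,
      permConcat_inv_inl γ β₃ f₃ f₃'' hl₃, permConcat_inv_inr γ β₁ f₁' f₁'' hr₁,
      permConcat_inv_inr γ β₂ f₂' f₂'' hr₂, permConcat_inv_inr γ β₃ f₃' f₃'' hr₃]
  exact LinearMap.congr_fun₂ this z z'

theorem permConcat₃_mulRight₃ (a₁ a₂ a₃ : PermAlg k) (a₁' a₂' a₃' : PermAlg k')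
    (z : PermTriple k) (z' : PermTriple k') :
    permConcat₃ γ β₁ β₂ β₃ (mulRight₃ a₁ a₂ a₃ z) (mulRight₃ a₁' a₂' a₃' z') =
      mulRight₃ (blockLeft β₁ a₁ * blockRight β₁ a₁') (blockLeft β₂ a₂ * blockRight β₂ a₂')
        (blockLeft β₃ a₃ * blockRight β₃ a₃') (permConcat₃ γ β₁ β₂ β₃ z z') :=
  map₂_map (fun x x' => permConcat_mul γ β₁ x a₁ x' a₁')
    (map₂_map (fun x x' => permConcat_mul γ β₂ x a₂ x' a₂')
      (fun x x' => permConcat_mul γ β₃ x a₃ x' a₃')) z z'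

end

theorem kronecker_ne_zero_iff {μ ν lam : YoungDiagram} :
    kronecker μ ν lam ≠ 0 ↔ ∃ (hm : μ.card = lam.card) (hn : ν.card = lam.card),
      ∃ z, rowTriplePoly rfl hm hn (mulRight₃ (lam.colAntisymmetriser rfl)
        (μ.colAntisymmetriser hm) (ν.colAntisymmetriser hn) z) ≠ 0 := by
  by_cases h : μ.card = lam.card ∧ ν.card = lam.card
  · rw [kronecker, dif_pos h, finrank_spechtRep_ne_zero_iff, exists_rowTriplePoly_ne_zero_iff]
    exact ⟨fun hz => ⟨h.1, h.2, hz⟩, fun ⟨_, _, hz⟩ => hz⟩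
  · rw [kronecker, dif_neg h]
    exact ⟨fun h0 => absurd rfl h0, fun ⟨h1, h2, _⟩ => absurd ⟨h1, h2⟩ h⟩

theorem kronecker_add_ne_zero {μ ν lam μ' ν' lam' : YoungDiagram}
    (h : kronecker μ ν lam ≠ 0) (h' : kronecker μ' ν' lam' ≠ 0) :
    kronecker (μ + μ') (ν + ν') (lam + lam') ≠ 0 := by
  rw [kronecker_ne_zero_iff] at h h' ⊢
  obtain ⟨hm, hn, z, hz⟩ := h
  obtain ⟨hm', hn', z', hz'⟩ := h'
  have hM : (μ + μ').card = (lam + lam').card := by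
    rw [YoungDiagram.card_rowAdd, YoungDiagram.card_rowAdd, hm, hm']
  have hN : (ν + ν').card = (lam + lam').card := by
    rw [YoungDiagram.card_rowAdd, YoungDiagram.card_rowAdd, hn, hn']
  obtain ⟨β₁, h₁⟩ := YoungDiagram.exists_isBoxSum (lam := lam) (lam' := lam') rfl rfl rfl
  obtain ⟨β₂, h₂⟩ := YoungDiagram.exists_isBoxSum hm hm' hM
  obtain ⟨β₃, h₃⟩ := YoungDiagram.exists_isBoxSum hn hn' hN
  -- Any bijection could serve as `γ`; `β₁` is merely available.
  refine ⟨hM, hN, permConcat₃ β₁ β₁ β₂ β₃ z z', ?_⟩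
  rw [h₁.colAntisymmetriser, h₂.colAntisymmetriser, h₃.colAntisymmetriser,
    ← permConcat₃_mulRight₃, rowTriplePoly, triplePoly_permConcat₃ β₁ β₁ β₂ β₃ h₁.row_inl h₁.row_inr
      h₂.row_inl h₂.row_inr h₃.row_inl h₃.row_inr]
  exact mul_ne_zero hz hz'

end

theorem mainTheorem3 :
    (∀ (d : ℕ) (μ ν lam μ' ν' lam' : YoungDiagram),
      littlewoodRichardson d μ ν lam ≠ 0 → littlewoodRichardson d μ' ν' lam' ≠ 0 →
        littlewoodRichardson d (μ + μ') (ν + ν') (lam + lam') ≠ 0) ∧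
    (∀ μ ν lam μ' ν' lam' : YoungDiagram,
      kronecker μ ν lam ≠ 0 → kronecker μ' ν' lam' ≠ 0 →
        kronecker (μ + μ') (ν + ν') (lam + lam') ≠ 0) :=
  ⟨fun _ _ _ _ _ _ _ => littlewoodRichardson_add_ne_zero,
    fun _ _ _ _ _ _ => kronecker_add_ne_zero⟩
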